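/- Let $R>0$ and let $\Omega\subset\mathbb R^2$ be the stadium-like domain $$\Omega=\{x=(x_1,x_2): |x_1|<R,\ |x_2|<1+\sqrt{R^2-x_1^2}\},$$ whose boundary consists of the two flat sides $\{\pm R\}\times[-1,1]$, orthogonal to $e_1$, and two circular arcs, which meet the flat sides at the four points $(\pm R,\pm1)$. Then there are a $C^\infty$, $1$-periodic function $g:\mathbb R\to\mathbb R$ of one variable and, for every $\varepsilon>0$, a function $u_\varepsilon\in C(\overline\Omega)$ that solves $$\Delta u_\varepsilon=0\ \text{ in }\Omega,\qquad u_\varepsilon(x)=g(x_1/\varepsilon)\ \text{ on }\partial\Omega,$$ and there is a sequence $\varepsilon_i>0$, $\varepsilon_i\to0$, such that $u_{\varepsilon_i}$ converges locally uniformly in $\Omega$ to a harmonic function $u$ whose boundary data are discontinuous at $(R,1)$. More precisely, there is a function $\varphi$ on $\partial\Omega$ such that $u(y)\to\varphi(x)$ as $y\to x$, $y\in\Omega$, for every $x\in\partial\Omega$ other than the four points $(\pm R,\pm 1)$; $\varphi=\int_0^1 g(t)\,dt$ at all points of $\partial\Omega$ with $|x_1|<R$; $\varphi=\max g$ on $\{R\}\times(-1,1)$;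 the function $\varphi$ has no limit at $(R,1)$ along $\partial\Omega\setminus\{(R,1)\}$ (so it is discontinuous there, whatever its value at that point); and $u(y)$ has no limit as $y\to(R,1)$, $y\in\Omega$. In particular, the homogenized boundary data can be discontinuous even though $g$ is smooth. -/

import Mathlib

open Set Filter Topology
open scoped ContDiff

/-- The stadium-like planar domain `{x : |x₁| < R, |x₂| < 1 + √(R² - x₁²)}`
(`x₁`, `x₂` are the coordinates `x 0`, `x 1`). -/
def stadium (R : ℝ) : Set (EuclideanSpace ℝ (Fin 2)) :=
  {x | |x 0| < R ∧ |x 1| < 1 + Real.sqrt (R ^ 2 - x 0 ^ 2)}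

/-- The four points `(±R, ±1)` where the flat sides of the stadium meet its circular arcs. -/
def stadiumJunctions (R : ℝ) : Set (EuclideanSpace ℝ (Fin 2)) :=
  {x | |x 0| = R ∧ |x 1| = 1}

/-- `u` is a classical solution of the Dirichlet problem `Δ u = 0` in `Ω`, `u = h` on `∂Ω`:
it is continuous on the closure of `Ω`, harmonic in `Ω`, and equal to `h` on the boundary. -/
structure IsDirichletSolution (Ω : Set (EuclideanSpace ℝ (Fin 2)))
    (h u : EuclideanSpace ℝ (Fin 2) → ℝ) : Prop where
  continuousOn : ContinuousOn u (closure Ω)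
  harmonic : InnerProductSpace.HarmonicOnNhd u Ω
  boundary : ∀ x ∈ frontier Ω, u x = h x

/-- `a` is the boundary value at `x` of a function `u` given in `Ω`:
`u y` tends to `a` as `y` tends to `x` inside `Ω`. -/
def HasBoundaryValue (Ω : Set (EuclideanSpace ℝ (Fin 2)))
    (u : EuclideanSpace ℝ (Fin 2) → ℝ) (x : EuclideanSpace ℝ (Fin 2)) (a : ℝ) : Prop :=
  Tendsto u (𝓝[Ω] x) (𝓝 a)

open Metric Complex MeasureTheory InnerProductSpace Real

/-! Take g(t) = cos(2πt) and ε = R/(n+1). The data then equal 1 = max g on both flat sides, while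
along the arcs x₁ varies and the data oscillate with mean 0. By the maximum principle the solutions
are bounded by 1, so `IsOpen.exists_subseq_harmonic_tendsto` extracts a harmonic limit. Its boundary
values come from estimates that are uniform in the frequency k.

At an inner point of a flat side, a harmonic quadratic polynomial vanishing there bounds the
solutions from below (`IsCosSolution.one_sub_flatBarrier_le`), so the limit tends to 1. Near an arc,
the solution is compared with the Poisson integral of cos(k x₁) over the full circle carrying the
arc. The two agree on the arc and differ by at most 2 on the diameter, so their difference is at
most a fixed multiple of an affine barrier (`IsCosSolution.abs_sub_poissonIntegral_le`). By the
Riemann–Lebesgue lemma the Poisson integral tends to 0 as k → ∞ (`tendsto_poissonIntegral_cos_re`);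
hence the limit is dominated by the barrier and tends to 0. Both values 1 and 0 accumulate at (R,
1).

Existence of the solutions is Poincaré's sweeping method
(`LocallySubmean.exists_dirichlet_solution`): a subharmonic extension of the data is replaced by
Poisson integrals in a sequence of discs, the increasing limit is harmonic, and barriers give the
boundary values. It applies because cos(k x₁) is a difference of two convex functions of x₁. The
analysis takes place in ℂ and is carried to the Euclidean plane by an isometry. -/

/-! ### Sub-mean value functions and the maximum principle. -/

/-- The local sub-mean value property on `s`. -/
def LocallySubmean (f : ℂ → ℝ) (s : Set ℂ) : Prop :=
  ∀ z ∈ s, ∃ ρ > 0, ∀ r ∈ Ioo 0 ρ, f z ≤ circleAverage f z r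

theorem ContinuousOn.circleIntegrable_of_closedBall_subset {f : ℂ → ℝ} {K : Set ℂ}
    (hf : ContinuousOn f K) {z : ℂ} {r : ℝ} (hr : 0 ≤ r) (h : closedBall z r ⊆ K) :
    CircleIntegrable f z r :=
  (hf.mono (sphere_subset_closedBall.trans h)).circleIntegrable hr

theorem IsOpen.exists_closedBall_subset {O : Set ℂ} (hO : IsOpen O) {z : ℂ} (hz : z ∈ O) :
    ∃ ρ > 0, closedBall z ρ ⊆ O :=
  nhds_basis_closedBall.mem_iff.1 (hO.mem_nhds hz)

theorem harmonicOnNhd_re_of_differentiable {F : ℂ → ℂ} (hF : Differentiable ℂ F) (s : Set ℂ) :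
    HarmonicOnNhd (fun z => (F z).re) s :=
  fun z _ => (hF.analyticAt z).harmonicAt_re

theorem InnerProductSpace.HarmonicOnNhd.circleAverage_of_closedBall {f : ℂ → ℝ} {z : ℂ} {r : ℝ}
    (hr : 0 ≤ r) (hf : HarmonicOnNhd f (closedBall z r)) : circleAverage f z r = f z :=
  HarmonicOnNhd.circleAverage_eq (by rwa [abs_of_nonneg hr])

theorem InnerProductSpace.HarmonicOnNhd.locallySubmean {f : ℂ → ℝ} {O : Set ℂ} (hO : IsOpen O)
    (hf : HarmonicOnNhd f O) : LocallySubmean f O := by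
  intro z hz
  obtain ⟨ρ, hρ, h⟩ := hO.exists_closedBall_subset hz
  refine ⟨ρ, hρ, fun r hr => (HarmonicOnNhd.circleAverage_of_closedBall hr.1.le
    (hf.mono ((closedBall_subset_closedBall hr.2.le).trans h))).ge⟩

theorem LocallySubmean.add {f g : ℂ → ℝ} {O : Set ℂ} (hO : IsOpen O) (hf : LocallySubmean f O)
    (hg : LocallySubmean g O) (hfc : ContinuousOn f O) (hgc : ContinuousOn g O) :
    LocallySubmean (fun z => f z + g z) O := by
  intro z hz
  obtain ⟨ρ, hρ, h⟩ := hO.exists_closedBall_subset hz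
  obtain ⟨ρ₁, hρ₁, h₁⟩ := hf z hz
  obtain ⟨ρ₂, hρ₂, h₂⟩ := hg z hz
  refine ⟨min ρ (min ρ₁ ρ₂), by positivity, fun r hr => ?_⟩
  have hr' : r < ρ ∧ r < ρ₁ ∧ r < ρ₂ := by simpa using hr.2
  have hsub := (closedBall_subset_closedBall (x := z) hr'.1.le).trans h
  rw [circleAverage_fun_add (hfc.circleIntegrable_of_closedBall_subset hr.1.le hsub)
    (hgc.circleIntegrable_of_closedBall_subset hr.1.le hsub)]
  exact add_le_add (h₁ r ⟨hr.1, hr'.2.1⟩) (h₂ r ⟨hr.1, hr'.2.2⟩)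

/-- On the circle ‖w‖² coincides with the real part of an affine function of w, whose average is its
value at the centre. -/
theorem circleAverage_norm_sq (z : ℂ) {r : ℝ} (hr : 0 ≤ r) :
    circleAverage (fun w => ‖w‖ ^ 2) z r = ‖z‖ ^ 2 + r ^ 2 := by
  have h := HarmonicOnNhd.circleAverage_of_closedBall hr (harmonicOnNhd_re_of_differentiable
    (F := fun w => 2 * ((starRingEnd ℂ) z * (w - z)) + ((‖z‖ ^ 2 + r ^ 2 : ℝ) : ℂ))
    (by fun_prop) (closedBall z r))
  have hc : EqOn (fun w => ‖w‖ ^ 2)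
      (fun w => (2 * ((starRingEnd ℂ) z * (w - z)) + ((‖z‖ ^ 2 + r ^ 2 : ℝ) : ℂ)).re)
      (sphere z |r|) := by
    intro w hw
    rw [abs_of_nonneg hr, mem_sphere_iff_norm] at hw
    simp only [← hw, ← normSq_eq_norm_sq, normSq_apply]
    simp
    ring
  rw [circleAverage_congr_sphere hc, h]
  simp [-ofReal_pow]

/-- The maximum principle for functions with the local sub-mean value property. -/
theorem LocallySubmean.le_of_forall_diff_le {f : ℂ → ℝ} {K O : Set ℂ} (hK : IsCompact K)
    (hO : IsOpen O) (hOK : O ⊆ K) (hf : ContinuousOn f K) (hs : LocallySubmean f O) {M : ℝ}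
    (hM : ∀ z ∈ K \ O, f z ≤ M) : ∀ z ∈ K, f z ≤ M := by
  intro z₀ hz₀
  by_contra! hlt
  obtain ⟨B, hB⟩ := hK.isBounded.exists_norm_le
  have hB0 : 0 ≤ B := (norm_nonneg z₀).trans (hB z₀ hz₀)
  -- Adding δ‖z‖² makes the sub-mean inequality strict, which excludes an interior maximum. This δ
  -- is so small that the perturbed value at z₀ still exceeds all perturbed values off `O`.
  set δ := (f z₀ - M) / (2 * (B ^ 2 + 1)) with hδ
  have hδ0 : 0 < δ := div_pos (by linarith) (by positivity)
  have hδB : δ * B ^ 2 < f z₀ - M := by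
    have : δ * (2 * (B ^ 2 + 1)) = f z₀ - M := by rw [hδ]; field_simp
    nlinarith [sq_nonneg B]
  have hsq : ∀ z ∈ K, ‖z‖ ^ 2 ≤ B ^ 2 := fun z hz => by gcongr; exact hB z hz
  have hgc : ContinuousOn (fun z => f z + δ * ‖z‖ ^ 2) K := by fun_prop
  obtain ⟨z₁, hz₁, hmax⟩ := hK.exists_isMaxOn ⟨z₀, hz₀⟩ hgc
  have h01 : f z₀ + δ * ‖z₀‖ ^ 2 ≤ f z₁ + δ * ‖z₁‖ ^ 2 := hmax hz₀
  have hz₁O : z₁ ∈ O := by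
    by_contra hcon
    have := hM z₁ ⟨hz₁, hcon⟩
    nlinarith [hsq z₁ hz₁, sq_nonneg ‖z₀‖, mul_le_mul_of_nonneg_left (hsq z₁ hz₁) hδ0.le,
      mul_nonneg hδ0.le (sq_nonneg ‖z₀‖)]
  obtain ⟨ρ, hρ, h⟩ := hO.exists_closedBall_subset hz₁O
  obtain ⟨ρ₁, hρ₁, h₁⟩ := hs z₁ hz₁O
  set r := min ρ ρ₁ / 2 with hr
  have hr0 : 0 < r := by positivity
  have hrρ : r < ρ := by have := min_le_left ρ ρ₁; linarith [lt_min hρ hρ₁]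
  have hrρ₁ : r < ρ₁ := by have := min_le_right ρ ρ₁; linarith [lt_min hρ hρ₁]
  have hsub : closedBall z₁ r ⊆ K :=
    ((closedBall_subset_closedBall hrρ.le).trans h).trans hOK
  have hfi := hf.circleIntegrable_of_closedBall_subset hr0.le hsub
  have hgi := hgc.circleIntegrable_of_closedBall_subset hr0.le hsub
  have hni : CircleIntegrable (fun z : ℂ => δ • ‖z‖ ^ 2) z₁ r :=
    (Continuous.continuousOn (by fun_prop)).circleIntegrable hr0.le
  have e1 : circleAverage (fun z => f z + δ * ‖z‖ ^ 2) z₁ r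
      = circleAverage f z₁ r + δ * (‖z₁‖ ^ 2 + r ^ 2) := by
    have := circleAverage_fun_add hfi hni
    rw [circleAverage_fun_smul, circleAverage_norm_sq _ hr0.le] at this
    simpa using this
  have e2 : circleAverage (fun z => f z + δ * ‖z‖ ^ 2) z₁ r ≤ f z₁ + δ * ‖z₁‖ ^ 2 := by
    refine circleAverage_mono_on_of_le_circle hgi fun x hx => hmax (hsub ?_)
    rw [abs_of_nonneg hr0.le] at hx
    exact sphere_subset_closedBall hx
  have e3 := h₁ r ⟨hr0, hrρ₁⟩
  nlinarith [mul_pos hδ0 (pow_pos hr0 2)]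

theorem LocallySubmean.le_of_le_diff {f h : ℂ → ℝ} {K O : Set ℂ} (hK : IsCompact K)
    (hO : IsOpen O) (hOK : O ⊆ K) (hf : ContinuousOn f K) (hs : LocallySubmean f O)
    (hh : ContinuousOn h K) (hharm : HarmonicOnNhd h O) (hle : ∀ z ∈ K \ O, f z ≤ h z) :
    ∀ z ∈ K, f z ≤ h z := by
  have hneg : HarmonicOnNhd (fun z => - h z) O := hharm.neg
  have := LocallySubmean.le_of_forall_diff_le (M := 0) hK hO hOK (hf.add hh.neg)
    (hs.add hO (hneg.locallySubmean hO) (hf.mono hOK) (hh.neg.mono hOK))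
    (fun z hz => by have := hle z hz; simp only [Pi.add_apply, Pi.neg_apply]; linarith)
  intro z hz
  have := this z hz
  simp only [Pi.add_apply, Pi.neg_apply] at this
  linarith

/-- Comparison of two harmonic functions. -/
theorem InnerProductSpace.HarmonicOnNhd.le_of_le_diff {f h : ℂ → ℝ} {K O : Set ℂ}
    (hK : IsCompact K) (hO : IsOpen O) (hOK : O ⊆ K) (hf : ContinuousOn f K)
    (hfh : HarmonicOnNhd f O) (hh : ContinuousOn h K) (hharm : HarmonicOnNhd h O)
    (hle : ∀ z ∈ K \ O, f z ≤ h z) : ∀ z ∈ K, f z ≤ h z :=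
  (hfh.locallySubmean hO).le_of_le_diff hK hO hOK hf hh hharm hle

theorem InnerProductSpace.HarmonicOnNhd.const_add_mul {w : ℂ → ℝ} {s : Set ℂ}
    (hw : HarmonicOnNhd w s) (a b : ℝ) : HarmonicOnNhd (fun z => a + b * w z) s :=
  (show HarmonicOnNhd (fun _ => a) s from fun _ _ => harmonicAt_const a).add
    (hw.const_smul (c := b))

/-! ### The Poisson integral. -/

/-- The Poisson integral over the circle of centre `c` and radius `r`. -/
noncomputable def poissonIntegral (f : ℂ → ℝ) (c : ℂ) (r : ℝ) (w : ℂ) : ℝ :=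
  circleAverage ((re ∘ herglotzRieszKernel c w) • f) c r

/-- The Poisson kernel is the real part of the Herglotz–Riesz kernel, so the integral is the real
part of an analytic function. Analyticity is taken from the case of centre 0, whence the
translations by `c`. -/
theorem harmonicOnNhd_poissonIntegral {f : ℂ → ℝ} {c : ℂ} {r : ℝ} (hf : CircleIntegrable f c r) :
    HarmonicOnNhd (poissonIntegral f c r) (ball c r) := by
  have hf0 : CircleIntegrable (fun z => f (z + c)) 0 r := by
    have : ∀ θ, circleMap 0 r θ + c = circleMap c r θ := fun θ => by simp [circleMap, add_comm]
    simpa [CircleIntegrable, this] using hf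
  have hf1 : CircleIntegrable (fun z => ((f (z + c) : ℝ) : ℂ)) 0 r := by
    exact ⟨hf0.1.ofReal, hf0.2.ofReal⟩
  have han := analyticOnNhd_circleAverage_herglotzRieszKernel_smul hf1
  intro w hw
  have hw0 : w - c ∈ ball (0 : ℂ) r := by simpa [dist_eq_norm] using hw
  have hcomp := (han (w - c) hw0).comp_of_eq (g := _) (f := fun w : ℂ => w - c)
    (x := w) (by fun_prop) rfl
  refine (harmonicAt_congr_nhds ?_).1 hcomp.harmonicAt_re
  filter_upwards [isOpen_ball.mem_nhds hw] with x hx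
  have hx0 : x - c ∈ ball (0 : ℂ) r := by simpa [dist_eq_norm] using hx
  have := re_circleAverage_herglotzRieszKernel_smul hf0 hx0
  simp only [Function.comp_apply]
  rw [this, poissonIntegral, ← circleAverage_map_add_const (c := c)]
  congr 1
  ext z
  simp [herglotzRieszKernel_add_const]

theorem re_herglotzRieszKernel_nonneg {c w z : ℂ} {r : ℝ} (hz : z ∈ sphere c r)
    (hw : w ∈ ball c r) : 0 ≤ (herglotzRieszKernel c w z).re := by
  refine le_trans ?_ (le_re_herglotzRieszKernel hz hw)
  rw [mem_ball_iff_norm] at hw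
  have := norm_nonneg (w - c)
  exact div_nonneg (by linarith) (by linarith)

theorem circleIntegrable_herglotz_smul {f : ℂ → ℝ} {c w : ℂ} {r : ℝ}
    (hf : CircleIntegrable f c r) (hw : w ∈ ball c r) :
    CircleIntegrable ((re ∘ herglotzRieszKernel c w) • f) c r :=
  hf.continuousOn_smul
    (continuous_re.comp_continuousOn (continuousOn_herglotzRieszKernel_sphere hw))

theorem poissonIntegral_mono {f g : ℂ → ℝ} {c w : ℂ} {r : ℝ} (hf : CircleIntegrable f c r)
    (hg : CircleIntegrable g c r) (hw : w ∈ ball c r) (h : ∀ z ∈ sphere c r, f z ≤ g z) :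
    poissonIntegral f c r w ≤ poissonIntegral g c r w := by
  refine circleAverage_mono (circleIntegrable_herglotz_smul hf hw)
    (circleIntegrable_herglotz_smul hg hw) fun z hz => ?_
  rw [abs_of_pos (pos_of_mem_ball hw)] at hz
  exact mul_le_mul_of_nonneg_left (h z hz) (re_herglotzRieszKernel_nonneg hz hw)

theorem InnerProductSpace.HarmonicContOnCl.poissonIntegral_eq {f : ℂ → ℝ} {c w : ℂ} {r : ℝ}
    (hf : HarmonicContOnCl f (ball c r)) (hw : w ∈ ball c r) : poissonIntegral f c r w = f w :=
  hf.circleAverage_re_herglotzRieszKernel_smul hw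

/-- A bounded pointwise limit of harmonic functions is harmonic. -/
theorem harmonicOnNhd_ball_of_tendsto {u : ℕ → ℂ → ℝ} {v : ℂ → ℝ} {c : ℂ} {r M : ℝ}
    (hu : ∀ n, HarmonicContOnCl (u n) (ball c r)) (hM : ∀ n, ∀ z ∈ closedBall c r, |u n z| ≤ M)
    (hv : ∀ z ∈ closedBall c r, Tendsto (fun n => u n z) atTop (𝓝 (v z))) :
    HarmonicOnNhd v (ball c r) := by
  rcases le_or_gt r 0 with hr | hr
  · simp [ball_eq_empty.2 hr, HarmonicOnNhd]
  have hmem : ∀ θ, circleMap c r θ ∈ closedBall c r := circleMap_mem_closedBall c hr.le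
  have hui : ∀ n, Continuous fun θ => u n (circleMap c r θ) := fun n =>
    (hu n).continuousOn_ball.comp_continuous (continuous_circleMap c r) hmem
  have hvi : CircleIntegrable v c r := by
    have hmeas : Measurable fun θ => v (circleMap c r θ) :=
      measurable_of_tendsto_metrizable (fun n => (hui n).measurable)
        (tendsto_pi_nhds.2 fun θ => hv _ (hmem θ))
    refine (intervalIntegrable_const (c := M)).mono_fun hmeas.aestronglyMeasurable ?_
    refine Eventually.of_forall fun θ => ?_
    have : |v (circleMap c r θ)| ≤ M :=
      le_of_tendsto (hv _ (hmem θ)).abs (Eventually.of_forall fun n => hM n _ (hmem θ))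
    simpa using this.trans (le_abs_self M)
  -- For fixed w the kernel is bounded on the circle, so the Poisson formula for the `u n` passes to
  -- the limit by dominated convergence.
  have heq : EqOn v (poissonIntegral v c r) (ball c r) := by
    intro w hw
    refine tendsto_nhds_unique (hv w (ball_subset_closedBall hw)) ?_
    simp_rw [← fun n => (hu n).poissonIntegral_eq hw]
    refine Tendsto.const_smul ?_ _
    refine intervalIntegral.tendsto_integral_filter_of_dominated_convergence
      (fun _ => (r + ‖w - c‖) / (r - ‖w - c‖) * M) ?_ ?_ intervalIntegrable_const ?_
    · refine Eventually.of_forall fun n => ?_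
      exact (intervalIntegrable_iff.1 (circleIntegrable_herglotz_smul (f := u n)
        ((hui n).intervalIntegrable _ _) hw)).aestronglyMeasurable
    · refine Eventually.of_forall fun n => Eventually.of_forall fun θ _ => ?_
      have hs := circleMap_mem_sphere c hr.le θ
      have h0 := re_herglotzRieszKernel_nonneg hs hw
      simp only [Pi.smul_apply', Function.comp_apply, smul_eq_mul, norm_mul, Real.norm_eq_abs,
        abs_of_nonneg h0]
      exact mul_le_mul (re_herglotzRieszKernel_le hs hw) (hM n _ (hmem θ)) (abs_nonneg _)
        (h0.trans (re_herglotzRieszKernel_le hs hw))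
    · refine Eventually.of_forall fun θ _ => ?_
      exact (hv _ (hmem θ)).const_mul _
  intro w hw
  refine (harmonicAt_congr_nhds ?_).1 (harmonicOnNhd_poissonIntegral hvi w hw)
  filter_upwards [isOpen_ball.mem_nhds hw] with x hx using (heq hx).symm

/-- An interior oscillation bound for bounded harmonic functions. -/
theorem InnerProductSpace.HarmonicContOnCl.abs_sub_center_le {u : ℂ → ℝ} {c w : ℂ} {r M : ℝ}
    (hu : HarmonicContOnCl u (ball c r)) (hM : ∀ z ∈ closedBall c r, |u z| ≤ M)
    (hw : w ∈ ball c r) : |u w - u c| ≤ 2 * ‖w - c‖ / (r - ‖w - c‖) * M := by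
  have hr := pos_of_mem_ball hw
  have hwn := mem_ball_iff_norm.1 hw
  have hui : CircleIntegrable u c r :=
    hu.continuousOn_ball.circleIntegrable_of_closedBall_subset hr.le subset_rfl
  have h1 := hu.poissonIntegral_eq hw
  have h2 : circleAverage u c r = u c :=
    HarmonicContOnCl.circleAverage_eq (by rwa [abs_of_pos hr])
  -- The difference is the average of (kernel − 1)·u, and the complex kernel minus 1 is 2(w − c)/(z
  -- − w).
  have h3 : circleAverage ((re ∘ herglotzRieszKernel c w) • u - u) c r = u w - u c := by
    rw [circleAverage_sub (circleIntegrable_herglotz_smul hui hw) hui, h2, ← h1, poissonIntegral]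
  rw [← h3]
  refine abs_circleAverage_le_circleAverage_abs.trans
    (circleAverage_mono_on_of_le_circle
      ((circleIntegrable_herglotz_smul hui hw).sub hui).abs fun z hz => ?_)
  rw [abs_of_pos hr] at hz
  have hzn := mem_sphere_iff_norm.1 hz
  have hne : z - c - (w - c) ≠ 0 := fun h => by
    rw [sub_eq_zero] at h; rw [h] at hzn; linarith
  have hk : herglotzRieszKernel c w z - 1 = 2 * (w - c) / (z - c - (w - c)) := by
    rw [herglotzRieszKernel_def]; field_simp; ring
  have hk' : |(herglotzRieszKernel c w z).re - 1| ≤ 2 * ‖w - c‖ / (r - ‖w - c‖) := by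
    have e : (herglotzRieszKernel c w z).re - 1 = (2 * (w - c) / (z - c - (w - c))).re := by
      rw [← hk]; simp
    rw [e]
    refine (abs_re_le_norm _).trans ?_
    rw [norm_div, norm_mul]
    have : r - ‖w - c‖ ≤ ‖z - c - (w - c)‖ := by
      rw [← hzn]; exact norm_sub_norm_le _ _
    have h2 : ‖(2 : ℂ)‖ = 2 := by norm_num
    rw [h2]
    gcongr
  have e : |(re ∘ herglotzRieszKernel c w) • u - u| z
      = |(herglotzRieszKernel c w z).re - 1| * |u z| := by
    rw [← abs_mul]; simp [sub_mul]
  rw [e]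
  exact mul_le_mul hk' (hM z (sphere_subset_closedBall hz)) (abs_nonneg _)
    ((abs_nonneg _).trans hk')


/-! ### Barriers and the Dirichlet problem in a disc. -/

/-- A continuous function on a compact set is controlled near `p` by a barrier at `p`. -/
theorem IsCompact.exists_abs_sub_le_add_mul {K : Set ℂ} (hK : IsCompact K) {f w : ℂ → ℝ}
    (hf : ContinuousOn f K) (hw : ContinuousOn w K) {p : ℂ} (hwp : 0 ≤ w p)
    (hw0 : ∀ z ∈ K, z ≠ p → 0 < w z) {ε : ℝ} (hε : 0 < ε) :
    ∃ A : ℝ, ∀ z ∈ K, |f z - f p| ≤ ε + A * w z := by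
  have hgc : ContinuousOn (fun z => |f z - f p|) K := by fun_prop
  have hw' : ∀ z ∈ K, 0 ≤ w z := fun z hz => by
    by_cases h : z = p
    · rwa [h]
    · exact (hw0 z hz h).le
  have hT : IsCompact (K ∩ (fun z => |f z - f p|) ⁻¹' Ici ε) :=
    hK.of_isClosed_subset (hgc.preimage_isClosed_of_isClosed hK.isClosed isClosed_Ici)
      inter_subset_left
  rcases (K ∩ (fun z => |f z - f p|) ⁻¹' Ici ε).eq_empty_or_nonempty with he | hne
  · refine ⟨0, fun z hz => ?_⟩
    by_contra! hlt
    have : z ∈ K ∩ (fun z => |f z - f p|) ⁻¹' Ici ε := ⟨hz, by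
      simp only [mem_preimage, mem_Ici]; linarith⟩
    simp [he] at this
  obtain ⟨z₁, hz₁, hmin⟩ := hT.exists_isMinOn hne (hw.mono inter_subset_left)
  have hz₁p : z₁ ≠ p := by
    rintro rfl
    have := hz₁.2
    simp only [mem_preimage, sub_self, abs_zero, mem_Ici] at this
    linarith
  have hm := hw0 z₁ hz₁.1 hz₁p
  obtain ⟨B, hB⟩ := hK.exists_bound_of_continuousOn hgc
  have hB0 : 0 ≤ B := (norm_nonneg _).trans (hB z₁ hz₁.1)
  -- `B` bounds |f − f p|, and `w z₁` is the positive minimum of the barrier over the compact set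
  -- where |f − f p| ≥ ε.
  refine ⟨B / w z₁, fun z hz => ?_⟩
  by_cases hzT : ε ≤ |f z - f p|
  · have h1 : w z₁ ≤ w z := hmin ⟨hz, hzT⟩
    have h2 : |f z - f p| ≤ B := by simpa using hB z hz
    have h3 : B ≤ B / w z₁ * w z := by
      rw [div_mul_eq_mul_div, le_div_iff₀ hm]
      exact mul_le_mul_of_nonneg_left h1 hB0
    linarith
  · have := mul_nonneg (div_nonneg hB0 hm.le) (hw' z hz)
    linarith

/-- The constant `A` may blow up as ε → 0: for each fixed ε the term `A * w` still vanishes at `p`.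
-/
theorem tendsto_of_forall_abs_sub_le {u w : ℂ → ℝ} {S : Set ℂ} {p : ℂ} {a : ℝ}
    (hw : Tendsto w (𝓝[S] p) (𝓝 0)) (h : ∀ ε > 0, ∃ A : ℝ, ∀ z ∈ S, |u z - a| ≤ ε + A * w z) :
    Tendsto u (𝓝[S] p) (𝓝 a) := by
  rw [Metric.tendsto_nhds]
  intro ε hε
  obtain ⟨A, hA⟩ := h (ε / 2) (half_pos hε)
  have h1 : Tendsto (fun z => ε / 2 + A * w z) (𝓝[S] p) (𝓝 (ε / 2)) := by
    simpa using (hw.const_mul A).const_add (ε / 2)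
  filter_upwards [h1.eventually_lt_const (half_lt_self hε), self_mem_nhdsWithin] with z hz hzS
  rw [Real.dist_eq]
  exact (hA z hzS).trans_lt hz

/-- The affine function which is positive on the disc of centre `c` off its boundary point `p`. -/
noncomputable def discBarrier (c p z : ℂ) : ℝ :=
  ((‖p - c‖ ^ 2 : ℝ) - (starRingEnd ℂ) (p - c) * (z - c)).re

theorem harmonicOnNhd_discBarrier (c p : ℂ) (s : Set ℂ) : HarmonicOnNhd (discBarrier c p) s :=
  harmonicOnNhd_re_of_differentiable (by fun_prop) s

theorem continuous_discBarrier (c p : ℂ) : Continuous (discBarrier c p) := by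
  unfold discBarrier
  fun_prop

/-- Polarization. In the disc ‖z − c‖ ≤ ‖p − c‖ the right side is at least ‖p − z‖²/2, the source of
positivity. -/
theorem discBarrier_eq (c p z : ℂ) :
    discBarrier c p z = (‖p - z‖ ^ 2 + ‖p - c‖ ^ 2 - ‖z - c‖ ^ 2) / 2 := by
  have : p - z = (p - c) - (z - c) := by ring
  rw [this, ← normSq_eq_norm_sq, ← normSq_eq_norm_sq (z - c), discBarrier, ← normSq_eq_norm_sq]
  simp only [normSq_apply]
  simp
  ring

theorem discBarrier_self (c p : ℂ) : discBarrier c p p = 0 := by simp [discBarrier_eq]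

theorem discBarrier_nonneg {c p z : ℂ} (hz : z ∈ closedBall c ‖p - c‖) :
    0 ≤ discBarrier c p z := by
  rw [mem_closedBall_iff_norm] at hz
  have := pow_le_pow_left₀ (norm_nonneg _) hz 2
  rw [discBarrier_eq]
  nlinarith [sq_nonneg ‖p - z‖]

theorem discBarrier_pos {c p z : ℂ} (hz : z ∈ closedBall c ‖p - c‖) (hzp : z ≠ p) :
    0 < discBarrier c p z := by
  rw [mem_closedBall_iff_norm] at hz
  have := pow_le_pow_left₀ (norm_nonneg _) hz 2
  have h2 : 0 < ‖p - z‖ := norm_pos_iff.2 (sub_ne_zero.2 hzp.symm)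
  rw [discBarrier_eq]
  nlinarith [pow_pos h2 2]

/-- Solution of the Dirichlet problem in a disc by the Poisson integral. -/
theorem exists_harmonicContOnCl_ball {f : ℂ → ℝ} {c : ℂ} {r : ℝ} (hr : 0 < r)
    (hf : ContinuousOn f (sphere c r)) :
    ∃ h : ℂ → ℝ, HarmonicContOnCl h (ball c r) ∧ EqOn h f (sphere c r) ∧
      EqOn h (poissonIntegral f c r) (ball c r) := by
  classical
  have hfi : CircleIntegrable f c r := hf.circleIntegrable hr.le
  set h : ℂ → ℝ := fun z => if z ∈ ball c r then poissonIntegral f c r z else f z with hh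
  have hball : EqOn h (poissonIntegral f c r) (ball c r) := fun z hz => if_pos hz
  have hsph : EqOn h f (sphere c r) := fun z hz => if_neg fun hz' => by
    rw [mem_ball] at hz'; rw [mem_sphere] at hz; linarith
  have hharm : HarmonicOnNhd h (ball c r) := fun w hw => by
    refine (harmonicAt_congr_nhds ?_).1 (harmonicOnNhd_poissonIntegral hfi w hw)
    filter_upwards [isOpen_ball.mem_nhds hw] with x hx using (hball hx).symm
  refine ⟨h, HarmonicContOnCl.mk_ball hharm fun p hp => ?_, hsph, hball⟩
  rcases lt_or_eq_of_le (mem_closedBall.1 hp) with hlt | heq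
  · exact (hharm p hlt).1.continuousAt.continuousWithinAt
  have hps : p ∈ sphere c r := heq
  have hpr : ‖p - c‖ = r := mem_sphere_iff_norm.1 hps
  rw [ContinuousWithinAt, hsph hps]
  have hw : ContinuousWithinAt (discBarrier c p) (closedBall c r) p :=
    (continuous_discBarrier c p).continuousWithinAt
  rw [ContinuousWithinAt, discBarrier_self] at hw
  refine tendsto_of_forall_abs_sub_le hw fun ε hε => ?_
  obtain ⟨A, hA⟩ := (isCompact_sphere c r).exists_abs_sub_le_add_mul hf
    (continuous_discBarrier c p).continuousOn (discBarrier_self c p).ge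
    (fun z hz hzp => discBarrier_pos (by rw [hpr]; exact sphere_subset_closedBall hz) hzp) hε
  refine ⟨A, fun z hz => ?_⟩
  rcases lt_or_eq_of_le (mem_closedBall.1 hz) with hlt | heq
  · have hzb : z ∈ ball c r := hlt
    -- The Poisson integral is monotone and reproduces these harmonic functions, so the barrier
    -- bound on the circle persists inside the disc.
    have key : ∀ a b : ℝ, HarmonicContOnCl (fun z => a + b * discBarrier c p z) (ball c r) :=
      fun a b => ((harmonicOnNhd_discBarrier c p univ).const_add_mul a b |>.mono
        (subset_univ _)).harmonicContOnCl
    have hci : ∀ a b : ℝ, CircleIntegrable (fun z => a + b * discBarrier c p z) c r :=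
      fun a b => (key a b).continuousOn_ball.circleIntegrable_of_closedBall_subset hr.le subset_rfl
    have h1 := poissonIntegral_mono hfi (hci (f p + ε) A) hzb fun x hx => by
      have := abs_le.1 (hA x hx); linarith
    have h2 := poissonIntegral_mono (hci (f p - ε) (-A)) hfi hzb fun x hx => by
      have := abs_le.1 (hA x hx); linarith
    rw [(key _ _).poissonIntegral_eq hzb] at h1 h2
    rw [hball hzb, abs_le]
    constructor <;> linarith
  · rw [hsph heq]
    exact hA z heq

/-! ### The Dirichlet problem by sweeping through discs. -/

/-- Poisson modification of a function with the local sub-mean value property. -/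
theorem LocallySubmean.exists_poisson_modification {Ω C : Set ℂ} (hΩ : IsOpen Ω) (hΩC : Ω ⊆ C)
    {v : ℂ → ℝ} (hv : ContinuousOn v C) (hs : LocallySubmean v Ω)
    {c : ℂ} {r : ℝ} (hr : 0 < r) (hB : closedBall c r ⊆ Ω) :
    ∃ v' : ℂ → ℝ, ContinuousOn v' C ∧ LocallySubmean v' Ω ∧ (∀ z ∈ C, v z ≤ v' z) ∧
      HarmonicContOnCl v' (ball c r) ∧
      ∀ W : ℂ → ℝ, ContinuousOn W C → HarmonicOnNhd W Ω → (∀ z ∈ C, v z ≤ W z) →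
        ∀ z ∈ C, v' z ≤ W z := by
  classical
  have hBC := hB.trans hΩC
  obtain ⟨h, hh, hhs, -⟩ := exists_harmonicContOnCl_ball hr
    (hv.mono (sphere_subset_closedBall.trans hBC))
  set v' : ℂ → ℝ := fun z => if z ∈ ball c r then h z else v z with hv'
  have hball : EqOn v' h (ball c r) := fun z hz => if_pos hz
  have hout : ∀ z ∉ ball c r, v' z = v z := fun z hz => if_neg hz
  have hcl : EqOn v' h (closedBall c r) := fun z hz => by
    by_cases hzb : z ∈ ball c r
    · exact hball hzb
    · rw [hout z hzb, hhs (mem_sphere.2 (le_antisymm hz (not_lt.1 hzb)))]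
  have hsphere : ∀ z ∈ closedBall c r \ ball c r, h z = v z := fun z hz =>
    hhs (mem_sphere.2 (le_antisymm hz.1 (not_lt.1 hz.2)))
  have hle : ∀ z ∈ closedBall c r, v z ≤ h z :=
    LocallySubmean.le_of_le_diff (isCompact_closedBall c r) isOpen_ball ball_subset_closedBall
      (hv.mono hBC) (fun z hz => hs z (hB (ball_subset_closedBall hz))) hh.continuousOn_ball hh.1
      fun z hz => (hsphere z hz).ge
  have hvv' : ∀ z ∈ C, v z ≤ v' z := fun z _ => by
    by_cases hzb : z ∈ ball c r
    · rw [hball hzb]; exact hle z (ball_subset_closedBall hzb)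
    · rw [hout z hzb]
  have hharm : HarmonicOnNhd v' (ball c r) := fun w hw => by
    refine (harmonicAt_congr_nhds ?_).1 (hh.1 w hw)
    filter_upwards [isOpen_ball.mem_nhds hw] with x hx using (hball hx).symm
  have hcont : ContinuousOn v' C := by
    have h1 : ContinuousOn v' (closedBall c r) := hh.continuousOn_ball.congr hcl
    have h2 : ContinuousOn v' (C \ ball c r) :=
      (hv.mono sdiff_subset).congr fun z hz => hout z hz.2
    intro z hz
    have e : C = closedBall c r ∪ C \ ball c r := by
      ext x
      constructor
      · intro hx
        by_cases hxb : x ∈ ball c r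
        · exact Or.inl (ball_subset_closedBall hxb)
        · exact Or.inr ⟨hx, hxb⟩
      · rintro (hx | hx)
        · exact hBC hx
        · exact hx.1
    by_cases hzb : z ∈ ball c r
    · exact (hharm z hzb).1.continuousAt.continuousWithinAt
    by_cases hzc : z ∈ closedBall c r
    · rw [e]
      exact (h1 z hzc).union (h2 z ⟨hz, hzb⟩)
    · have h3 := h2 z ⟨hz, hzb⟩
      refine h3.mono_of_mem_nhdsWithin ?_
      have : (closedBall c r)ᶜ ∈ 𝓝 z := isClosed_closedBall.isOpen_compl.mem_nhds hzc
      filter_upwards [self_mem_nhdsWithin, mem_nhdsWithin_of_mem_nhds this] with x hx hx'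
      exact ⟨hx, fun hxb => hx' (ball_subset_closedBall hxb)⟩
  refine ⟨v', hcont, ?_, hvv', HarmonicContOnCl.mk_ball hharm (hcont.mono hBC), ?_⟩
  · intro z hz
    by_cases hzb : z ∈ ball c r
    · exact hharm.locallySubmean isOpen_ball z hzb
    -- Off the open disc the value at z is unchanged, while the averages can only grow because v ≤
    -- v'.
    · obtain ⟨ρ, hρ, h⟩ := hΩ.exists_closedBall_subset hz
      obtain ⟨ρ₁, hρ₁, h₁⟩ := hs z hz
      refine ⟨min ρ ρ₁, by positivity, fun s hs' => ?_⟩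
      have hs2 : s < ρ ∧ s < ρ₁ := by simpa using hs'.2
      have hsub := ((closedBall_subset_closedBall (x := z) hs2.1.le).trans h).trans hΩC
      rw [hout z hzb]
      refine (h₁ s ⟨hs'.1, hs2.2⟩).trans (circleAverage_mono
        (hv.circleIntegrable_of_closedBall_subset hs'.1.le hsub)
        (hcont.circleIntegrable_of_closedBall_subset hs'.1.le hsub) fun x hx => hvv' x ?_)
      rw [abs_of_pos hs'.1] at hx
      exact hsub (sphere_subset_closedBall hx)
  · intro W hWc hWh hvW z hz
    by_cases hzb : z ∈ ball c r
    · rw [hball hzb]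
      exact HarmonicOnNhd.le_of_le_diff (isCompact_closedBall c r) isOpen_ball
        ball_subset_closedBall hh.continuousOn_ball hh.1 (hWc.mono hBC)
        (hWh.mono (ball_subset_closedBall.trans hB))
        (fun x hx => by rw [hsphere x hx]; exact hvW x (hBC hx.1)) z (ball_subset_closedBall hzb)
    · rw [hout z hzb]; exact hvW z hz

/-- An open set is exhausted by a sequence of discs in which each disc of a cover occurs
infinitely often. -/
theorem IsOpen.exists_seq_closedBall {Ω : Set ℂ} (hΩ : IsOpen Ω) (hne : Ω.Nonempty) :
    ∃ (c : ℕ → ℂ) (r : ℕ → ℝ), (∀ n, 0 < r n) ∧ (∀ n, closedBall (c n) (r n) ⊆ Ω) ∧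
      ∀ z ∈ Ω, ∃ (a : ℂ) (s : ℝ), z ∈ ball a s ∧
        ∃ φ : ℕ → ℕ, StrictMono φ ∧ ∀ j, c (φ j) = a ∧ r (φ j) = s := by
  have hex : ∀ z : Ω, ∃ ρ > 0, closedBall (z : ℂ) ρ ⊆ Ω := fun z =>
    hΩ.exists_closedBall_subset z.2
  choose ρ hρ hρΩ using hex
  have : Nonempty Ω := hne.to_subtype
  obtain ⟨t, ht, htu⟩ := TopologicalSpace.isOpen_iUnion_countable (fun z : Ω => ball (z : ℂ) (ρ z))
    fun z => isOpen_ball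
  have htne : t.Nonempty := by
    obtain ⟨z⟩ := this
    have : (z : ℂ) ∈ ⋃ i ∈ t, ball (i : ℂ) (ρ i) := by
      rw [htu]; exact mem_iUnion.2 ⟨z, mem_ball_self (hρ z)⟩
    obtain ⟨i, hi, -⟩ := mem_iUnion₂.1 this
    exact ⟨i, hi⟩
  obtain ⟨f, hf⟩ := ht.exists_eq_range htne
  -- The first component of `Nat.unpair` takes each value infinitely often.
  refine ⟨fun n => f n.unpair.1, fun n => ρ (f n.unpair.1), fun n => hρ _, fun n => hρΩ _, ?_⟩
  intro z hz
  have hzm : z ∈ ⋃ i ∈ t, ball (i : ℂ) (ρ i) := by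
    rw [htu]; exact mem_iUnion.2 ⟨⟨z, hz⟩, mem_ball_self (hρ _)⟩
  obtain ⟨i, hi, hzi⟩ := mem_iUnion₂.1 hzm
  rw [hf] at hi
  obtain ⟨m, rfl⟩ := hi
  refine ⟨f m, ρ (f m), hzi, fun j => Nat.pair m j, fun a b hab => Nat.pair_lt_pair_right _ hab,
    fun j => by simp⟩

/-- Solution of the Dirichlet problem whose data extend to a continuous function with the local
sub-mean value property, in a domain with a barrier at each boundary point. -/
theorem LocallySubmean.exists_dirichlet_solution {Ω C : Set ℂ} (hΩ : IsOpen Ω)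
    (hne : Ω.Nonempty) (hC : IsCompact C) (hΩC : Ω ⊆ C)
    (hbar : ∀ p ∈ C \ Ω, ∃ w : ℂ → ℝ, Continuous w ∧ HarmonicOnNhd w Ω ∧ w p = 0 ∧
      ∀ z ∈ C, z ≠ p → 0 < w z)
    {f : ℂ → ℝ} (hf : ContinuousOn f C) (hs : LocallySubmean f Ω) :
    ∃ u : ℂ → ℝ, ContinuousOn u C ∧ HarmonicOnNhd u Ω ∧ ∀ p ∈ C \ Ω, u p = f p := by
  obtain ⟨c, r, hr, hB, hcov⟩ := hΩ.exists_seq_closedBall hne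
  choose! T hTc hTs hTle hTh hTW using fun (n : ℕ) (v : ℂ → ℝ)
    (hv : ContinuousOn v C ∧ LocallySubmean v Ω) =>
      LocallySubmean.exists_poisson_modification hΩ hΩC hv.1 hv.2 (hr n) (hB n)
  let v : ℕ → ℂ → ℝ := fun n => Nat.rec f (fun n g => T n g) n
  have hv0 : v 0 = f := rfl
  have hvs : ∀ n, v (n + 1) = T n (v n) := fun n => rfl
  have hv : ∀ n, ContinuousOn (v n) C ∧ LocallySubmean (v n) Ω := fun n => by
    induction n with
    | zero => exact ⟨hf, hs⟩
    | succ n ih => rw [hvs]; exact ⟨hTc n _ ih, hTs n _ ih⟩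
  have hmono : ∀ z ∈ C, Monotone fun n => v n z := fun z hz =>
    monotone_nat_of_le_succ fun n => by rw [hvs]; exact hTle n _ (hv n) z hz
  have hW : ∀ W : ℂ → ℝ, ContinuousOn W C → HarmonicOnNhd W Ω → (∀ z ∈ C, f z ≤ W z) →
      ∀ n, ∀ z ∈ C, v n z ≤ W z := fun W h1 h2 h3 n => by
    induction n with
    | zero => exact h3
    | succ n ih => rw [hvs]; exact hTW n _ (hv n) W h1 h2 ih
  obtain ⟨M, hM⟩ := hC.exists_bound_of_continuousOn hf
  have hfM : ∀ z ∈ C, -M ≤ f z ∧ f z ≤ M := fun z hz => abs_le.1 (hM z hz)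
  have hvM : ∀ n, ∀ z ∈ C, |v n z| ≤ M := fun n z hz => abs_le.2
    ⟨(hfM z hz).1.trans (hmono z hz (Nat.zero_le n)),
      hW (fun _ => M) continuousOn_const (fun _ _ => harmonicAt_const M)
        (fun x hx => (hfM x hx).2) n z hz⟩
  set u : ℂ → ℝ := fun z => ⨆ n, v n z with hu
  have hlim : ∀ z ∈ C, Tendsto (fun n => v n z) atTop (𝓝 (u z)) := fun z hz =>
    tendsto_atTop_ciSup (hmono z hz) ⟨M, by rintro _ ⟨n, rfl⟩; exact (abs_le.1 (hvM n z hz)).2⟩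
  have hfu : ∀ z ∈ C, f z ≤ u z := fun z hz =>
    ge_of_tendsto (hlim z hz) (Eventually.of_forall fun n => hmono z hz (Nat.zero_le n))
  have huW : ∀ W : ℂ → ℝ, ContinuousOn W C → HarmonicOnNhd W Ω → (∀ z ∈ C, f z ≤ W z) →
      ∀ z ∈ C, u z ≤ W z := fun W h1 h2 h3 z hz =>
    le_of_tendsto (hlim z hz) (Eventually.of_forall fun n => hW W h1 h2 h3 n z hz)
  have hharm : HarmonicOnNhd u Ω := by
    intro z hz
    obtain ⟨a, s, hzs, φ, hφ, hφB⟩ := hcov z hz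
    have hsub : closedBall a s ⊆ C := by
      have := (hB (φ 0)).trans hΩC
      rwa [(hφB 0).1, (hφB 0).2] at this
    -- Step `φ j` sweeps this disc, so it is `v (φ j + 1)` that is harmonic there; the monotone
    -- sequence has the same limit along this subsequence.
    refine harmonicOnNhd_ball_of_tendsto (M := M) (u := fun j => v (φ j + 1)) (fun j => ?_)
      (fun j x hx => hvM (φ j + 1) x (hsub hx)) (fun x hx => ?_) z hzs
    · have := hTh (φ j) (v (φ j)) (hv _)
      rwa [(hφB j).1, (hφB j).2] at this
    · exact (hlim x (hsub hx)).comp ((tendsto_add_atTop_nat 1).comp hφ.tendsto_atTop)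
  have hsq : ∀ p ∈ C \ Ω, ∃ w : ℂ → ℝ, Continuous w ∧ w p = 0 ∧
      ∀ ε > 0, ∃ A : ℝ, ∀ z ∈ C, |u z - f p| ≤ ε + A * w z := by
    intro p hp
    obtain ⟨w, hwc, hwh, hwp, hw0⟩ := hbar p hp
    refine ⟨w, hwc, hwp, fun ε hε => ?_⟩
    obtain ⟨A, hA⟩ := hC.exists_abs_sub_le_add_mul hf hwc.continuousOn hwp.ge hw0 hε
    refine ⟨A, fun z hz => ?_⟩
    -- The barrier gives a harmonic majorant of f, which every sweep respects. The lower bound needs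
    -- only f ≤ u.
    have h1 := huW (fun z => (f p + ε) + A * w z) (by fun_prop) (hwh.const_add_mul _ _)
      (fun x hx => by have := abs_le.1 (hA x hx); linarith) z hz
    have h2 := abs_le.1 (hA z hz)
    have h3 := hfu z hz
    rw [abs_le]
    constructor <;> linarith
  have hup : ∀ p ∈ C \ Ω, u p = f p := by
    intro p hp
    obtain ⟨w, -, hwp, hw⟩ := hsq p hp
    refine eq_of_abs_sub_nonpos (le_of_forall_pos_le_add fun ε hε => ?_)
    obtain ⟨A, hA⟩ := hw ε hε
    simpa [hwp] using hA p hp.1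
  refine ⟨u, fun p hp => ?_, hharm, hup⟩
  by_cases hpΩ : p ∈ Ω
  · exact (hharm p hpΩ).1.continuousAt.continuousWithinAt
  obtain ⟨w, hwc, hwp, hw⟩ := hsq p ⟨hp, hpΩ⟩
  rw [ContinuousWithinAt, hup p ⟨hp, hpΩ⟩]
  refine tendsto_of_forall_abs_sub_le ?_ hw
  have := hwc.continuousWithinAt (s := C) (x := p)
  rwa [ContinuousWithinAt, hwp] at this

/-- Convex functions are suprema of affine ones, and an affine function of Re z is harmonic. A
minorant almost touching at Re z, with defect tending to 0, suffices. -/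
theorem ConvexOn.locallySubmean_re {F : ℝ → ℝ} (hF : ConvexOn ℝ univ F) (s : Set ℂ) :
    LocallySubmean (fun z => F z.re) s := by
  have hFc : Continuous F := continuousOn_univ.1 (hF.continuousOn isOpen_univ)
  refine fun z _ => ⟨1, one_pos, fun r hr => le_of_forall_lt fun a ha => ?_⟩
  obtain ⟨b, hab, hb⟩ := exists_between ha
  obtain ⟨c, c', hle, heq⟩ := hF.exists_affine_le_of_lt_real (mem_univ z.re) hb isClosed_univ
    (hFc.lowerSemicontinuous.lowerSemicontinuousOn _)
  have h := HarmonicOnNhd.circleAverage_of_closedBall hr.1.le (harmonicOnNhd_re_of_differentiable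
    (F := fun w => c * w + c') (by fun_prop) (closedBall z r))
  have h2 : circleAverage (fun w : ℂ => ((c : ℂ) * w + c').re) z r
      ≤ circleAverage (fun w : ℂ => F w.re) z r :=
    circleAverage_mono ((Continuous.continuousOn (by fun_prop)).circleIntegrable hr.1.le)
      ((Continuous.continuousOn (by fun_prop)).circleIntegrable hr.1.le)
      fun w _ => by simpa using hle w.re (mem_univ _)
  rw [h] at h2
  simp only [add_re, re_ofReal_mul, ofReal_re, heq] at h2
  linarith

/-- Solution of the Dirichlet problem with data `cos (k x₁)`. -/
theorem exists_dirichlet_solution_cos_re {Ω C : Set ℂ} (hΩ : IsOpen Ω)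
    (hne : Ω.Nonempty) (hC : IsCompact C) (hΩC : Ω ⊆ C)
    (hbar : ∀ p ∈ C \ Ω, ∃ w : ℂ → ℝ, Continuous w ∧ HarmonicOnNhd w Ω ∧ w p = 0 ∧
      ∀ z ∈ C, z ≠ p → 0 < w z) (k : ℝ) :
    ∃ u : ℂ → ℝ, ContinuousOn u C ∧ HarmonicOnNhd u Ω ∧
      ∀ p ∈ C \ Ω, u p = Real.cos (k * p.re) := by
  have hsq' : ∀ t : ℝ, HasDerivAt (fun t : ℝ => k ^ 2 * t ^ 2 / 2) (k ^ 2 * t) t := fun t => by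
    refine (((hasDerivAt_pow 2 t).const_mul (k ^ 2)).div_const 2).congr_deriv ?_
    push_cast
    ring
  have hsq'' : ∀ t : ℝ, HasDerivAt (fun t : ℝ => k ^ 2 * t) (k ^ 2) t := fun t => by
    simpa using (hasDerivAt_id t).const_mul (k ^ 2)
  have hkt : ∀ t : ℝ, HasDerivAt (fun t : ℝ => k * t) k t := fun t => by
    simpa using (hasDerivAt_id t).const_mul k
  have hsq : ConvexOn ℝ univ fun t : ℝ => k ^ 2 * t ^ 2 / 2 :=
    convexOn_of_hasDerivWithinAt2_nonneg convex_univ (Continuous.continuousOn (by fun_prop))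
      (fun t _ => (hsq' t).hasDerivWithinAt) (fun t _ => (hsq'' t).hasDerivWithinAt)
      fun _ _ => sq_nonneg k
  -- The second derivative is k²(1 − cos(kt)) ≥ 0.
  have hconv : ConvexOn ℝ univ fun t : ℝ => k ^ 2 * t ^ 2 / 2 + Real.cos (k * t) :=
    convexOn_of_hasDerivWithinAt2_nonneg convex_univ (Continuous.continuousOn (by fun_prop))
      (fun t _ => ((hsq' t).add (hkt t).cos).hasDerivWithinAt)
      (fun t _ => ((hsq'' t).add ((hkt t).sin.neg.mul_const k)).hasDerivWithinAt)
      fun t _ => by nlinarith [Real.cos_le_one (k * t), sq_nonneg k]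
  obtain ⟨u₁, h1c, h1h, h1b⟩ := LocallySubmean.exists_dirichlet_solution hΩ hne hC hΩC hbar
    (f := fun z => k ^ 2 * z.re ^ 2 / 2 + Real.cos (k * z.re))
    (Continuous.continuousOn (by fun_prop)) (hconv.locallySubmean_re Ω)
  obtain ⟨u₂, h2c, h2h, h2b⟩ := LocallySubmean.exists_dirichlet_solution hΩ hne hC hΩC hbar
    (f := fun z => k ^ 2 * z.re ^ 2 / 2)
    (Continuous.continuousOn (by fun_prop)) (hsq.locallySubmean_re Ω)
  refine ⟨u₁ - u₂, h1c.sub h2c, h1h.sub h2h, fun p hp => ?_⟩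
  simp [h1b p hp, h2b p hp]

/-! ### Compactness of bounded harmonic sequences. -/

/-- Uniformly bounded harmonic functions are equicontinuous in the interior. -/
theorem IsOpen.exists_ball_forall_harmonic_abs_sub_le {Ω : Set ℂ} (hΩ : IsOpen Ω) {z : ℂ}
    (hz : z ∈ Ω) {M η : ℝ} (hM : 0 < M) (hη : 0 < η) :
    ∃ s > 0, ball z s ⊆ Ω ∧ ∀ u : ℂ → ℝ, HarmonicOnNhd u Ω → (∀ x ∈ Ω, |u x| ≤ M) →
      ∀ w ∈ ball z s, |u w - u z| ≤ η := by
  obtain ⟨ρ, hρ, h⟩ := hΩ.exists_closedBall_subset hz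
  -- The solution of 2s/(ρ − s)·M = η.
  set s := ρ * η / (η + 2 * M) with hs
  have hs0 : 0 < s := by positivity
  have hρs : ρ - s = ρ * (2 * M) / (η + 2 * M) := by rw [hs]; field_simp; ring
  have hρs0 : 0 < ρ - s := by rw [hρs]; positivity
  refine ⟨s, hs0, (ball_subset_ball (by linarith)).trans (ball_subset_closedBall.trans h),
    fun u hu hb w hw => ?_⟩
  have hwn := mem_ball_iff_norm.1 hw
  have hcl : HarmonicContOnCl u (ball z ρ) :=
    HarmonicContOnCl.mk_ball (hu.mono (ball_subset_closedBall.trans h)) (hu.mono h).continuousOn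
  refine (hcl.abs_sub_center_le (fun x hx => hb x (h hx))
    (ball_subset_ball (by linarith) hw)).trans ?_
  calc 2 * ‖w - z‖ / (ρ - ‖w - z‖) * M ≤ 2 * s / (ρ - s) * M := by
        gcongr
    _ = η := by rw [hρs, hs]; field_simp

/-- A uniformly bounded sequence of harmonic functions has a locally uniformly convergent
subsequence with harmonic limit. -/
theorem IsOpen.exists_subseq_harmonic_tendsto {Ω : Set ℂ} (hΩ : IsOpen Ω) {u : ℕ → ℂ → ℝ} {M : ℝ}
    (hM : 0 < M) (hu : ∀ n, HarmonicOnNhd (u n) Ω) (hb : ∀ n, ∀ z ∈ Ω, |u n z| ≤ M) :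
    ∃ (φ : ℕ → ℕ) (v : ℂ → ℝ), StrictMono φ ∧ HarmonicOnNhd v Ω ∧
      TendstoLocallyUniformlyOn (fun n => u (φ n)) v atTop Ω := by
  classical
  let d := TopologicalSpace.denseSeq ℂ
  -- Values at a dense sequence lie in a compact product of intervals, which replaces a diagonal
  -- argument. The default 0 keeps the coordinates outside `Ω` in range.
  let x : ℕ → ℕ → ℝ := fun n m => if d m ∈ Ω then u n (d m) else 0
  have hx : ∀ n, x n ∈ Set.pi univ fun _ : ℕ => Icc (-M) M := fun n m _ => by
    by_cases h : d m ∈ Ω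
    · simpa [x, h] using abs_le.1 (hb n _ h)
    · simp [x, h, hM.le]
  obtain ⟨a, -, φ, hφ, ha⟩ := (isCompact_univ_pi fun _ => isCompact_Icc).tendsto_subseq hx
  have had : ∀ m, d m ∈ Ω → Tendsto (fun n => u (φ n) (d m)) atTop (𝓝 (a m)) := fun m hm => by
    simpa [x, hm, Function.comp_def] using tendsto_pi_nhds.1 ha m
  have hcau : ∀ z ∈ Ω, ∃ l, Tendsto (fun n => u (φ n) z) atTop (𝓝 l) := fun z hz => by
    refine cauchySeq_tendsto_of_complete (Metric.cauchySeq_iff.2 fun η hη => ?_)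
    obtain ⟨s, hs, hsΩ, hsu⟩ :=
      hΩ.exists_ball_forall_harmonic_abs_sub_le hz hM (show 0 < η / 4 by linarith)
    obtain ⟨m, hm⟩ := (TopologicalSpace.denseRange_denseSeq ℂ).exists_mem_open
      isOpen_ball (nonempty_ball.2 hs)
    obtain ⟨N, hN⟩ := Metric.cauchySeq_iff.1 (had m (hsΩ hm)).cauchySeq (η / 4) (by linarith)
    refine ⟨N, fun i hi j hj => ?_⟩
    have h1 := abs_le.1 (hsu _ (hu (φ i)) (hb (φ i)) _ hm)
    have h2 := abs_le.1 (hsu _ (hu (φ j)) (hb (φ j)) _ hm)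
    have h3 := hN i hi j hj
    rw [Real.dist_eq] at h3 ⊢
    have h3 := abs_lt.1 h3
    rw [abs_lt]
    constructor <;> linarith
  choose! v hv using hcau
  have hvu : ∀ z ∈ Ω, ∀ η > 0, ∃ s > 0, ball z s ⊆ Ω ∧
      (∀ n, ∀ w ∈ ball z s, |u n w - u n z| ≤ η) ∧ ∀ w ∈ ball z s, |v w - v z| ≤ η := by
    intro z hz η hη
    obtain ⟨s, hs, hsΩ, hsu⟩ := hΩ.exists_ball_forall_harmonic_abs_sub_le hz hM hη
    refine ⟨s, hs, hsΩ, fun n w hw => hsu _ (hu n) (hb n) w hw, fun w hw => ?_⟩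
    exact le_of_tendsto ((hv w (hsΩ hw)).sub (hv z hz)).abs
      (Eventually.of_forall fun n => hsu _ (hu _) (hb _) w hw)
  refine ⟨φ, v, hφ, fun z hz => ?_, ?_⟩
  · obtain ⟨ρ, hρ, h⟩ := hΩ.exists_closedBall_subset hz
    exact harmonicOnNhd_ball_of_tendsto (u := fun n => u (φ n))
      (fun n => HarmonicContOnCl.mk_ball ((hu _).mono (ball_subset_closedBall.trans h))
        ((hu _).mono h).continuousOn)
      (fun n x hx => hb (φ n) x (h hx)) (fun x hx => hv x (h hx)) z (mem_ball_self hρ)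
  · rw [Metric.tendstoLocallyUniformlyOn_iff]
    intro η hη z hz
    obtain ⟨s, hs, hsΩ, hsu, hsv⟩ := hvu z hz (η / 4) (by linarith)
    refine ⟨ball z s, mem_nhdsWithin_of_mem_nhds (ball_mem_nhds z hs), ?_⟩
    have := Metric.tendsto_nhds.1 (hv z hz) (η / 4) (by linarith)
    filter_upwards [this] with n hn w hw
    rw [Real.dist_eq] at hn ⊢
    have h1 := abs_le.1 (hsu (φ n) w hw)
    have h2 := abs_le.1 (hsv w hw)
    have h3 := abs_lt.1 hn
    rw [abs_lt]
    constructor <;> linarith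

/-! ### Averaging of oscillating data on a circle. -/

/-- The substitution t = cos θ turns the integral into the real part of a Fourier integral of
F(arccos t)/sin(arccos t) on (−1, 1), to which the Riemann–Lebesgue lemma applies. -/
theorem tendsto_integral_mul_cos_cos {F : ℝ → ℝ} (hF : Continuous F) :
    Tendsto (fun w : ℝ => ∫ θ in (0 : ℝ)..π, F θ * Real.cos (2 * π * w * Real.cos θ)) atTop
      (𝓝 0) := by
  set s := Ioo (0 : ℝ) π with hs
  set G : ℝ → ℂ := fun t => (F (Real.arccos t) / Real.sin (Real.arccos t) : ℝ) with hG
  have hRL := (Real.tendsto_integral_exp_smul_cocompact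
    ((Real.cos '' s).indicator G)).mono_left atTop_le_cocompact
  have hms : MeasurableSet s := measurableSet_Ioo
  have hinj : InjOn Real.cos s := Real.injOn_cos.mono Ioo_subset_Icc_self
  have hmi : MeasurableSet (Real.cos '' s) :=
    hms.image_of_continuousOn_injOn Real.continuous_cos.continuousOn hinj
  have key : ∀ w : ℝ, ∫ θ in (0 : ℝ)..π, F θ * Real.cos (2 * π * w * Real.cos θ)
      = (∫ v : ℝ, Real.fourierChar (-(v * w)) • (Real.cos '' s).indicator G v).re := by
    intro w
    have e1 : (fun v : ℝ => Real.fourierChar (-(v * w)) • (Real.cos '' s).indicator G v)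
        = (Real.cos '' s).indicator fun v => Real.fourierChar (-(v * w)) • G v := by
      ext v
      by_cases hv : v ∈ Real.cos '' s <;> simp [hv]
    rw [e1, integral_indicator hmi, integral_image_eq_integral_abs_deriv_smul hms
      (fun θ _ => (Real.hasDerivAt_cos θ).hasDerivWithinAt) hinj]
    have e2 : ∀ θ ∈ s, |-Real.sin θ| • (Real.fourierChar (-(Real.cos θ * w)) • G (Real.cos θ))
        = Real.fourierChar (-(Real.cos θ * w)) • (F θ : ℂ) := by
      intro θ hθ
      have hsin := Real.sin_pos_of_mem_Ioo hθ
      rw [hG]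
      simp only [Real.arccos_cos hθ.1.le hθ.2.le]
      rw [abs_neg, abs_of_pos hsin, smul_comm]
      congr 1
      rw [Complex.real_smul, ← ofReal_mul]
      congr 1
      field_simp
    rw [setIntegral_congr_fun hms e2]
    have hci : Continuous fun θ : ℝ => Real.fourierChar (-(Real.cos θ * w)) • (F θ : ℂ) := by
      simp only [Circle.smul_def, Real.fourierChar_apply]
      fun_prop
    have hint : IntegrableOn
        (fun θ : ℝ => Real.fourierChar (-(Real.cos θ * w)) • (F θ : ℂ)) s :=
      (hci.integrableOn_Icc (a := 0) (b := π)).mono_set Ioo_subset_Icc_self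
    rw [intervalIntegral.integral_of_le pi_pos.le, integral_Ioc_eq_integral_Ioo]
    have := reCLM.integral_comp_comm hint
    simp only [reCLM_apply] at this
    rw [← this]
    refine setIntegral_congr_fun hms fun θ _ => ?_
    simp only [Circle.smul_def, Real.fourierChar_apply, smul_eq_mul, re_mul_ofReal]
    rw [exp_ofReal_mul_I_re, mul_comm]
    congr 1
    rw [← Real.cos_neg]
    congr 1
    ring
  simp_rw [key]
  exact (continuous_re.tendsto' 0 0 zero_re).comp hRL

/-- The second half circle reduces to the first, since θ ↦ θ + π changes the sign of cos θ and the
outer cosine is even. -/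
theorem tendsto_integral_two_pi_mul_cos_cos {F : ℝ → ℝ} (hF : Continuous F) :
    Tendsto (fun w : ℝ => ∫ θ in (0 : ℝ)..2 * π, F θ * Real.cos (2 * π * w * Real.cos θ)) atTop
      (𝓝 0) := by
  have h1 := tendsto_integral_mul_cos_cos hF
  have h2 := tendsto_integral_mul_cos_cos (F := fun θ => F (θ + π)) (by fun_prop)
  have key : ∀ w : ℝ, ∫ θ in (0 : ℝ)..2 * π, F θ * Real.cos (2 * π * w * Real.cos θ)
      = (∫ θ in (0 : ℝ)..π, F θ * Real.cos (2 * π * w * Real.cos θ))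
        + ∫ θ in (0 : ℝ)..π, F (θ + π) * Real.cos (2 * π * w * Real.cos θ) := by
    intro w
    have hc : Continuous fun θ => F θ * Real.cos (2 * π * w * Real.cos θ) := by fun_prop
    rw [← intervalIntegral.integral_add_adjacent_intervals (b := π)
      (hc.intervalIntegrable _ _) (hc.intervalIntegrable _ _)]
    congr 1
    have := intervalIntegral.integral_comp_add_right (a := 0) (b := π)
      (fun θ => F θ * Real.cos (2 * π * w * Real.cos θ)) π
    rw [zero_add, ← two_mul] at this
    rw [← this]
    simp [Real.cos_add_pi]
  simp_rw [key]
  simpa using h1.add h2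

/-- Poisson integrals of `cos (k x₁)` over a circle centred on the imaginary axis vanish as
`k → ∞`. -/
theorem tendsto_poissonIntegral_cos_re {c z : ℂ} {r : ℝ} (hc : c.re = 0) (hz : z ∈ ball c r) :
    Tendsto (fun k : ℝ => poissonIntegral (fun x => Real.cos (k * x.re)) c r z) atTop (𝓝 0) := by
  have hr := pos_of_mem_ball hz
  have hF : Continuous fun θ => (herglotzRieszKernel c z (circleMap c r θ)).re :=
    continuous_re.comp ((continuousOn_herglotzRieszKernel_sphere hz).comp_continuous
      (continuous_circleMap c r) (circleMap_mem_sphere' c r))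
  -- As Re c = 0, the data on the circle are cos(k r cos θ), that is w = k r/(2π).
  have hlim := (tendsto_integral_two_pi_mul_cos_cos hF).comp
    (tendsto_id.atTop_mul_const (show 0 < r / (2 * π) by positivity))
  have := hlim.const_mul (2 * π)⁻¹
  rw [mul_zero] at this
  refine this.congr fun k => ?_
  simp only [poissonIntegral, circleAverage, Function.comp_apply, Pi.smul_apply', smul_eq_mul, id]
  congr 1
  refine intervalIntegral.integral_congr fun θ _ => ?_
  simp only [circleMap, add_re, hc, zero_add, re_ofReal_mul, exp_ofReal_mul_I_re]
  congr 2
  field_simp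

/-! ### The stadium in ℂ and its barriers. -/

/-- The stadium as a subset of `ℂ`. -/
def complexStadium (R : ℝ) : Set ℂ :=
  {z | |z.re| < R ∧ |z.im| < 1 + √(R ^ 2 - z.re ^ 2)}

/-- The closed stadium as a subset of `ℂ`. -/
def closedComplexStadium (R : ℝ) : Set ℂ :=
  {z | |z.re| ≤ R ∧ |z.im| ≤ 1 + √(R ^ 2 - z.re ^ 2)}

theorem isOpen_complexStadium (R : ℝ) : IsOpen (complexStadium R) :=
  show IsOpen ({z : ℂ | |z.re| < R} ∩ {z | |z.im| < 1 + √(R ^ 2 - z.re ^ 2)}) from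
    (isOpen_lt (by fun_prop) (by fun_prop)).inter (isOpen_lt (by fun_prop) (by fun_prop))

theorem isClosed_closedComplexStadium (R : ℝ) : IsClosed (closedComplexStadium R) :=
  show IsClosed ({z : ℂ | |z.re| ≤ R} ∩ {z | |z.im| ≤ 1 + √(R ^ 2 - z.re ^ 2)}) from
    (isClosed_le (by fun_prop) (by fun_prop)).inter (isClosed_le (by fun_prop) (by fun_prop))

theorem complexStadium_subset (R : ℝ) : complexStadium R ⊆ closedComplexStadium R :=
  fun _ hz => ⟨hz.1.le, hz.2.le⟩

theorem isCompact_closedComplexStadium (R : ℝ) : IsCompact (closedComplexStadium R) := by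
  refine (isCompact_closedBall (0 : ℂ) (R + (1 + √(R ^ 2)))).of_isClosed_subset
    (isClosed_closedComplexStadium R) fun z hz => ?_
  rw [mem_closedBall_zero_iff]
  refine (norm_le_abs_re_add_abs_im z).trans (add_le_add hz.1 (hz.2.trans ?_))
  gcongr
  nlinarith [sq_nonneg z.re]

theorem zero_mem_complexStadium {R : ℝ} (hR : 0 < R) : (0 : ℂ) ∈ complexStadium R := by
  constructor
  · simpa using hR
  · simp only [zero_im, abs_zero]
    positivity

theorem closedComplexStadium_diff {R : ℝ} {p : ℂ}
    (hp : p ∈ closedComplexStadium R \ complexStadium R) :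
    (|p.re| = R ∧ |p.im| ≤ 1) ∨ (|p.re| < R ∧ |p.im| = 1 + √(R ^ 2 - p.re ^ 2)) := by
  obtain ⟨⟨h1, h2⟩, h3⟩ := hp
  rcases h1.lt_or_eq with h | h
  · refine Or.inr ⟨h, le_antisymm h2 (not_lt.1 fun h4 => h3 ⟨h, h4⟩)⟩
  · refine Or.inl ⟨h, ?_⟩
    rw [← h, sq_abs, sub_self, Real.sqrt_zero, add_zero] at h2
    exact h2

theorem sq_lt_of_abs_re_lt {R x : ℝ} (h : |x| < R) : 0 < R ^ 2 - x ^ 2 := by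
  have := sq_lt_sq' (abs_lt.1 h).1 (abs_lt.1 h).2
  linarith

/-- The sign τ allows the two flat sides, and likewise the two arcs, to be treated at once. -/
theorem exists_abs_eq_mul (x : ℝ) : ∃ τ : ℝ, |τ| = 1 ∧ |x| = τ * x := by
  rcases abs_cases x with h | h
  · exact ⟨1, by simp, by simp [h.1]⟩
  · exact ⟨-1, by simp, by simp [h.1]⟩

theorem mul_le_abs_of_abs_eq_one {τ : ℝ} (hτ : |τ| = 1) (x : ℝ) : τ * x ≤ |x| := by
  have := le_abs_self (τ * x)
  rwa [abs_mul, hτ, one_mul] at this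

theorem sq_eq_one_of_abs_eq_one {τ : ℝ} (hτ : |τ| = 1) : τ ^ 2 = 1 := by
  rw [← sq_abs, hτ, one_pow]

/-- A harmonic polynomial vanishing at the point `(τ R, y)` of a flat side and positive at the
other points of the strip `|x₁| ≤ R`. -/
noncomputable def flatBarrier (R τ y : ℝ) (z : ℂ) : ℝ :=
  (-(z - y * I) ^ 2 - τ * z + ((R ^ 2 + R : ℝ) : ℂ)).re

theorem harmonicOnNhd_flatBarrier (R τ y : ℝ) (s : Set ℂ) :
    HarmonicOnNhd (flatBarrier R τ y) s :=
  harmonicOnNhd_re_of_differentiable (by fun_prop) s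

theorem continuous_flatBarrier (R τ y : ℝ) : Continuous (flatBarrier R τ y) := by
  unfold flatBarrier
  fun_prop

/-- The linear term −τz supplies the +1 in the last factor, which is therefore at least 1 in the
strip; without it the barrier would also vanish on the opposite side. -/
theorem flatBarrier_eq {R τ : ℝ} (hτ : |τ| = 1) (y : ℝ) (z : ℂ) :
    flatBarrier R τ y z = (z.im - y) ^ 2 + (R - τ * z.re) * (R + τ * z.re + 1) := by
  have h := sq_eq_one_of_abs_eq_one hτ
  simp only [flatBarrier, pow_two, add_re, sub_re, neg_re, mul_re, sub_im, ofReal_re, ofReal_im,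
    mul_im, I_re, I_im]
  linear_combination z.re ^ 2 * h

theorem le_flatBarrier {R τ : ℝ} (hτ : |τ| = 1) (y : ℝ) {z : ℂ} (hz : |z.re| ≤ R) :
    (z.im - y) ^ 2 + (R - τ * z.re) ≤ flatBarrier R τ y z := by
  rw [flatBarrier_eq hτ]
  have h1 := (mul_le_abs_of_abs_eq_one hτ z.re).trans hz
  have h2 := (mul_le_abs_of_abs_eq_one (τ := -τ) (by rwa [abs_neg]) z.re).trans hz
  nlinarith

theorem sub_nonneg_of_abs_re_le {R τ : ℝ} (hτ : |τ| = 1) {z : ℂ} (hz : |z.re| ≤ R) :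
    0 ≤ R - τ * z.re :=
  sub_nonneg.2 ((mul_le_abs_of_abs_eq_one hτ z.re).trans hz)

theorem norm_sq_sub_mul_I (σ : ℝ) (z : ℂ) : ‖z - σ * I‖ ^ 2 = z.re ^ 2 + (z.im - σ) ^ 2 := by
  rw [← normSq_eq_norm_sq, normSq_apply]
  simp
  ring

theorem discBarrier_mul_I (σ : ℝ) (p z : ℂ) : discBarrier (σ * I) p z
    = p.re ^ 2 + (p.im - σ) ^ 2 - p.re * z.re - (p.im - σ) * (z.im - σ) := by
  have h : ‖p - z‖ ^ 2 = (p.re - z.re) ^ 2 + (p.im - z.im) ^ 2 := by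
    rw [← normSq_eq_norm_sq, normSq_apply]
    simp
    ring
  rw [discBarrier_eq, norm_sq_sub_mul_I, norm_sq_sub_mul_I, h]
  ring

theorem sq_im_sub_of_arc {R σ : ℝ} (hσ : |σ| = 1) {p : ℂ}
    (hp : σ * p.im = 1 + √(R ^ 2 - p.re ^ 2)) : p.im - σ = σ * √(R ^ 2 - p.re ^ 2) := by
  have h := sq_eq_one_of_abs_eq_one hσ
  linear_combination σ * hp - p.im * h

/-- The tangent line at a point of an arc supports the whole stadium, which is not contained in the
disc, so `discBarrier_pos` does not apply. With b and e the heights of the arc at p and z, the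
barrier is half the squared distance from p to the arc point above z, plus b times the vertical gap
of z below the arc. -/
theorem discBarrier_pos_of_arc {R σ : ℝ} (hσ : |σ| = 1) {p z : ℂ} (hpR : |p.re| < R)
    (hp : σ * p.im = 1 + √(R ^ 2 - p.re ^ 2)) (hz : z ∈ closedComplexStadium R) (hzp : z ≠ p) :
    0 < discBarrier (σ * I) p z := by
  have h := sq_eq_one_of_abs_eq_one hσ
  have hp' := sq_im_sub_of_arc hσ hp
  have hb := Real.sqrt_pos.2 (sq_lt_of_abs_re_lt hpR)
  have hb2 := Real.sq_sqrt (sq_lt_of_abs_re_lt hpR).le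
  have he2 : √(R ^ 2 - z.re ^ 2) ^ 2 = R ^ 2 - z.re ^ 2 := Real.sq_sqrt (by
    have := sq_le_sq' (abs_le.1 hz.1).1 (abs_le.1 hz.1).2
    linarith)
  have hy := (mul_le_abs_of_abs_eq_one hσ z.im).trans hz.2
  rw [discBarrier_mul_I, hp']
  set b := √(R ^ 2 - p.re ^ 2)
  set e := √(R ^ 2 - z.re ^ 2)
  have key : p.re ^ 2 + (σ * b) ^ 2 - p.re * z.re - σ * b * (z.im - σ)
      = ((p.re - z.re) ^ 2 + (b - e) ^ 2) / 2 + b * (1 + e - σ * z.im) := by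
    linear_combination (b ^ 2 + b) * h + (1 / 2) * hb2 - (1 / 2) * he2
  rw [key]
  have h3 : 0 ≤ b * (1 + e - σ * z.im) := mul_nonneg hb.le (by linarith)
  refine lt_of_le_of_ne (by positivity) fun h0 => hzp ?_
  have h4 : (p.re - z.re) ^ 2 = 0 := by nlinarith [sq_nonneg (p.re - z.re), sq_nonneg (b - e)]
  have h5 : (b - e) ^ 2 = 0 := by nlinarith [sq_nonneg (p.re - z.re), sq_nonneg (b - e)]
  have h6 : b * (1 + e - σ * z.im) = 0 := by
    nlinarith [sq_nonneg (p.re - z.re), sq_nonneg (b - e)]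
  have h4' := pow_eq_zero_iff two_ne_zero |>.1 h4
  have h5' := pow_eq_zero_iff two_ne_zero |>.1 h5
  have h6' := (mul_eq_zero.1 h6).resolve_left hb.ne'
  refine Complex.ext (by linarith) ?_
  linear_combination (-z.im) * h + p.im * h + σ * (-hp - h5' - h6')

theorem exists_barrier_complexStadium {R : ℝ} (p : ℂ)
    (hp : p ∈ closedComplexStadium R \ complexStadium R) :
    ∃ w : ℂ → ℝ, Continuous w ∧ HarmonicOnNhd w (complexStadium R) ∧ w p = 0 ∧
      ∀ z ∈ closedComplexStadium R, z ≠ p → 0 < w z := by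
  rcases closedComplexStadium_diff hp with ⟨h1, -⟩ | ⟨h1, h2⟩
  · obtain ⟨τ, hτ, hτp⟩ := exists_abs_eq_mul p.re
    refine ⟨flatBarrier R τ p.im, continuous_flatBarrier _ _ _, harmonicOnNhd_flatBarrier _ _ _ _,
      ?_, fun z hz hzp => ?_⟩
    · rw [flatBarrier_eq hτ, ← hτp, h1]
      ring
    · refine lt_of_lt_of_le ?_ (le_flatBarrier hτ p.im hz.1)
      have h0 := sub_nonneg_of_abs_re_le hτ hz.1
      refine lt_of_le_of_ne (by positivity) fun h => hzp ?_
      have e1 : (z.im - p.im) ^ 2 = 0 := by nlinarith [sq_nonneg (z.im - p.im)]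
      have e2 : τ * z.re = τ * p.re := by nlinarith [sq_nonneg (z.im - p.im)]
      have hτ0 : τ ≠ 0 := by rintro rfl; simp at hτ
      exact Complex.ext (mul_left_cancel₀ hτ0 e2)
        (sub_eq_zero.1 (pow_eq_zero_iff two_ne_zero |>.1 e1))
  · obtain ⟨σ, hσ, hσp⟩ := exists_abs_eq_mul p.im
    rw [hσp] at h2
    refine ⟨discBarrier (σ * I) p, continuous_discBarrier _ _, harmonicOnNhd_discBarrier _ _ _,
      discBarrier_self _ _, fun z hz hzp => discBarrier_pos_of_arc hσ h1 h2 hz hzp⟩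

/-! ### Estimates uniform in the frequency. -/

/-- The solution of the Dirichlet problem in the stadium with data `cos (k x₁)`. -/
structure IsCosSolution (R k : ℝ) (u : ℂ → ℝ) : Prop where
  continuousOn : ContinuousOn u (closedComplexStadium R)
  harmonic : HarmonicOnNhd u (complexStadium R)
  boundary : ∀ p ∈ closedComplexStadium R \ complexStadium R, u p = Real.cos (k * p.re)

theorem exists_isCosSolution {R : ℝ} (hR : 0 < R) (k : ℝ) : ∃ u, IsCosSolution R k u := by
  obtain ⟨u, h1, h2, h3⟩ := exists_dirichlet_solution_cos_re (isOpen_complexStadium R)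
    ⟨0, zero_mem_complexStadium hR⟩ (isCompact_closedComplexStadium R) (complexStadium_subset R)
    exists_barrier_complexStadium k
  exact ⟨u, h1, h2, h3⟩

namespace IsCosSolution

variable {R k : ℝ} {u : ℂ → ℝ}

theorem le_of_boundary (hu : IsCosSolution R k u) {h : ℂ → ℝ} (hh : Continuous h)
    (hharm : HarmonicOnNhd h (complexStadium R))
    (hle : ∀ p ∈ closedComplexStadium R \ complexStadium R, Real.cos (k * p.re) ≤ h p) :
    ∀ z ∈ closedComplexStadium R, u z ≤ h z :=
  hu.harmonic.le_of_le_diff (isCompact_closedComplexStadium R) (isOpen_complexStadium R)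
    (complexStadium_subset R) hu.continuousOn hh.continuousOn hharm
    fun p hp => (hu.boundary p hp).trans_le (hle p hp)

theorem ge_of_boundary (hu : IsCosSolution R k u) {h : ℂ → ℝ} (hh : Continuous h)
    (hharm : HarmonicOnNhd h (complexStadium R))
    (hle : ∀ p ∈ closedComplexStadium R \ complexStadium R, h p ≤ Real.cos (k * p.re)) :
    ∀ z ∈ closedComplexStadium R, h z ≤ u z :=
  hharm.le_of_le_diff (isCompact_closedComplexStadium R) (isOpen_complexStadium R)
    (complexStadium_subset R) hh.continuousOn hu.continuousOn hu.harmonic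
    fun p hp => (hle p hp).trans_eq (hu.boundary p hp).symm

theorem abs_le_one (hu : IsCosSolution R k u) : ∀ z ∈ closedComplexStadium R, |u z| ≤ 1 :=
  fun z hz => abs_le.2
    ⟨hu.ge_of_boundary continuous_const (fun _ _ => harmonicAt_const (-1 : ℝ))
      (fun _ _ => Real.neg_one_le_cos _) z hz,
    hu.le_of_boundary continuous_const (fun _ _ => harmonicAt_const (1 : ℝ))
      (fun _ _ => Real.cos_le_one _) z hz⟩

/-- If the data equal `1` on the flat sides, then the solution is bounded below near them
independently of `k`. -/
theorem one_sub_flatBarrier_le (hu : IsCosSolution R k u) (hk : Real.cos (k * R) = 1) {τ y : ℝ}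
    (hτ : |τ| = 1) (hy : |y| < 1) : ∀ z ∈ closedComplexStadium R,
      1 + -(2 / (1 - |y|) ^ 2) * flatBarrier R τ y z ≤ u z := by
  have hy0 : 0 < 1 - |y| := by linarith
  refine hu.ge_of_boundary ((continuous_flatBarrier R τ y).const_mul _ |>.const_add _)
    ((harmonicOnNhd_flatBarrier R τ y _).const_add_mul _ _) fun p hp => ?_
  have hb := le_flatBarrier hτ y hp.1.1
  have h0 := sub_nonneg_of_abs_re_le hτ hp.1.1
  rcases closedComplexStadium_diff hp with ⟨h1, -⟩ | ⟨-, h2⟩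
  · have : Real.cos (k * p.re) = 1 := by
      rcases abs_choice p.re with h | h
      · rw [← h, h1, hk]
      · rw [h] at h1
        rw [← hk, ← h1, mul_neg, Real.cos_neg]
    rw [this]
    have : 0 ≤ 2 / (1 - |y|) ^ 2 * flatBarrier R τ y p := by
      have : 0 ≤ flatBarrier R τ y p := by nlinarith [sq_nonneg (p.im - y)]
      positivity
    linarith
  -- On the arcs |Im p| ≥ 1, so the scaled barrier is at least 2 there, the largest possible gap
  -- between 1 and the data.
  · have h3 : 1 - |y| ≤ |p.im - y| := by
      have := abs_sub_abs_le_abs_sub p.im y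
      have := Real.sqrt_nonneg (R ^ 2 - p.re ^ 2)
      linarith
    have h4 : (1 - |y|) ^ 2 ≤ flatBarrier R τ y p := by
      have := pow_le_pow_left₀ hy0.le h3 2
      rw [sq_abs] at this
      linarith
    have h5 : 2 ≤ 2 / (1 - |y|) ^ 2 * flatBarrier R τ y p := by
      rw [div_mul_eq_mul_div, le_div_iff₀ (by positivity)]
      linarith
    linarith [Real.neg_one_le_cos (k * p.re)]

/-- Near an arc the solution is close to the Poisson integral of its data over the circle. -/
theorem abs_sub_poissonIntegral_le (hu : IsCosSolution R k u) (hR : 0 < R) {σ : ℝ} (hσ : |σ| = 1)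
    {p : ℂ} (hpR : |p.re| < R) (hp : σ * p.im = 1 + √(R ^ 2 - p.re ^ 2)) :
    ∀ z ∈ ball (σ * I : ℂ) R, 1 < σ * z.im →
      |u z - poissonIntegral (fun x => Real.cos (k * x.re)) (σ * I) R z|
        ≤ 2 / (R * (R - |p.re|)) * discBarrier (σ * I) p z := by
  have hσ2 := sq_eq_one_of_abs_eq_one hσ
  have hpb := Real.sq_sqrt (sq_lt_of_abs_re_lt hpR).le
  have hp' := sq_im_sub_of_arc hσ hp
  have hpc : p.re ^ 2 + (p.im - σ) ^ 2 = R ^ 2 := by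
    rw [hp']
    linear_combination hpb + √(R ^ 2 - p.re ^ 2) ^ 2 * hσ2
  have hpn : ‖p - σ * I‖ = R := by
    rw [← sq_eq_sq₀ (norm_nonneg _) hR.le, norm_sq_sub_mul_I, hpc]
  have hδ : 0 < R * (R - |p.re|) := mul_pos hR (by linarith)
  set A := 2 / (R * (R - |p.re|)) with hA
  obtain ⟨D, hD, hDs, hDP⟩ := exists_harmonicContOnCl_ball hR
    (f := fun x : ℂ => Real.cos (k * x.re)) (c := σ * I) (Continuous.continuousOn (by fun_prop))
  have hball : ∀ z ∈ closedBall (σ * I : ℂ) R, z.re ^ 2 + (z.im - σ) ^ 2 ≤ R ^ 2 := fun z hz => by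
    rw [← norm_sq_sub_mul_I]
    exact pow_le_pow_left₀ (norm_nonneg _) (mem_closedBall_iff_norm.1 hz) 2
  have hsq : ∀ z : ℂ, (z.im - σ) ^ 2 = (σ * z.im - 1) ^ 2 := fun z => by
    linear_combination (1 - z.im ^ 2) * hσ2
  have habs : ∀ z : ℂ, 1 ≤ σ * z.im → |z.im| = σ * z.im := fun z hz => by
    rw [← abs_of_nonneg (zero_le_one.trans hz), abs_mul, hσ, one_mul]
  -- The half disc under the arc, where u and the Poisson extension `D` are compared. They agree on
  -- the circular part of its boundary.
  set K : Set ℂ := closedBall (σ * I : ℂ) R ∩ {z | 1 ≤ σ * z.im} with hK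
  set O : Set ℂ := ball (σ * I : ℂ) R ∩ {z | 1 < σ * z.im} with hO
  have hKc : IsCompact K :=
    (isCompact_closedBall _ _).inter_right (isClosed_le (by fun_prop) (by fun_prop))
  have hOo : IsOpen O := isOpen_ball.inter (isOpen_lt (by fun_prop) (by fun_prop))
  have hOK : O ⊆ K := fun z hz => ⟨ball_subset_closedBall hz.1, le_of_lt (show 1 < σ * z.im from hz.2)⟩
  have hKC : K ⊆ closedComplexStadium R := fun z hz => by
    have h1 := hball z hz.1
    have h2 : |z.re| ≤ R := abs_le_of_sq_le_sq (by nlinarith [sq_nonneg (z.im - σ)]) hR.le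
    refine ⟨h2, ?_⟩
    rw [habs z hz.2]
    have : σ * z.im - 1 ≤ √(R ^ 2 - z.re ^ 2) := Real.le_sqrt_of_sq_le (by
      rw [← hsq]; linarith)
    linarith
  have hOS : O ⊆ complexStadium R := fun z hz => by
    have h1 : z.re ^ 2 + (z.im - σ) ^ 2 < R ^ 2 := by
      rw [← norm_sq_sub_mul_I]
      exact pow_lt_pow_left₀ (mem_ball_iff_norm.1 hz.1) (norm_nonneg _) two_ne_zero
    have hz2 : 1 < σ * z.im := hz.2
    refine ⟨abs_lt_of_sq_lt_sq (by nlinarith [sq_nonneg (z.im - σ)]) hR.le, ?_⟩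
    rw [habs z hz2.le]
    have : σ * z.im - 1 < √(R ^ 2 - z.re ^ 2) := Real.lt_sqrt_of_sq_lt (by
      rw [← hsq]; linarith)
    linarith
  have hb0 : ∀ z ∈ K, 0 ≤ discBarrier (σ * I) p z := fun z hz =>
    discBarrier_nonneg (by rw [hpn]; exact hz.1)
  have hbd : ∀ z ∈ K \ O, |u z - D z| ≤ A * discBarrier (σ * I) p z := by
    intro z hz
    by_cases hzb : z ∈ ball (σ * I : ℂ) R
    · have hzi : σ * z.im = 1 := le_antisymm (not_lt.1 fun h => hz.2 ⟨hzb, h⟩) hz.1.2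
      have hzσ : z.im = σ := by linear_combination σ * hzi - z.im * hσ2
      have h1 : |u z| ≤ 1 := hu.abs_le_one z (hKC hz.1)
      have h2 : |D z| ≤ 1 := by
        have hci : CircleIntegrable (fun x : ℂ => Real.cos (k * x.re)) (σ * I) R :=
          (Continuous.continuousOn (by fun_prop)).circleIntegrable hR.le
        have hcc : ∀ a : ℝ, HarmonicContOnCl (fun _ : ℂ => a) (ball (σ * I : ℂ) R) :=
          fun a => harmonicContOnCl_const
        rw [hDP hzb, abs_le]
        have e1 := poissonIntegral_mono hci (circleIntegrable_const 1 _ _) hzb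
          fun x _ => Real.cos_le_one _
        have e2 := poissonIntegral_mono (circleIntegrable_const (-1) _ _) hci hzb
          fun x _ => Real.neg_one_le_cos _
        rw [(hcc _).poissonIntegral_eq hzb] at e1 e2
        exact ⟨e2, e1⟩
      -- On the diameter the barrier is R² − Re p · Re z; hence the constant `A`, which makes it
      -- dominate |u − D| ≤ 2.
      have h3 : R * (R - |p.re|) ≤ discBarrier (σ * I) p z := by
        rw [discBarrier_mul_I, hpc, hzσ]
        have h4 : p.re * z.re ≤ |p.re| * R := by
          refine (le_abs_self _).trans ?_
          rw [abs_mul]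
          exact mul_le_mul_of_nonneg_left (hKC hz.1).1 (abs_nonneg _)
        nlinarith
      have h4 : 2 ≤ A * discBarrier (σ * I) p z := by
        rw [hA, div_mul_eq_mul_div, le_div_iff₀ hδ]
        linarith
      have := abs_sub (u z) (D z)
      linarith
    · have hzs : z ∈ sphere (σ * I : ℂ) R :=
        mem_sphere.2 (le_antisymm hz.1.1 (not_lt.1 hzb))
      have hzn : z.re ^ 2 + (z.im - σ) ^ 2 = R ^ 2 := by
        rw [← norm_sq_sub_mul_I, mem_sphere_iff_norm.1 hzs]
      have hzS : z ∉ complexStadium R := fun h => by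
        have h1 := h.2
        rw [habs z hz.1.2] at h1
        have h2 : √(R ^ 2 - z.re ^ 2) = σ * z.im - 1 := by
          rw [← hzn, hsq, add_sub_cancel_left]
          exact Real.sqrt_sq (sub_nonneg.2 hz.1.2)
        linarith
      rw [hu.boundary z ⟨hKC hz.1, hzS⟩, hDs hzs, sub_self, abs_zero]
      exact mul_nonneg (by positivity) (hb0 z hz.1)
  have hDc : ContinuousOn D K := hD.continuousOn_ball.mono inter_subset_left
  have hDh : HarmonicOnNhd D O := hD.1.mono inter_subset_left
  have huc : ContinuousOn u K := hu.continuousOn.mono hKC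
  have huh : HarmonicOnNhd u O := hu.harmonic.mono hOS
  have hbc : ContinuousOn (fun z => 0 + A * discBarrier (σ * I) p z) K :=
    ((continuous_discBarrier _ p).const_mul A |>.const_add 0).continuousOn
  have hbh : HarmonicOnNhd (fun z => 0 + A * discBarrier (σ * I) p z) O :=
    (harmonicOnNhd_discBarrier _ p O).const_add_mul 0 A
  have hu1 := HarmonicOnNhd.le_of_le_diff hKc hOo hOK (huc.sub hDc) (huh.sub hDh) hbc hbh
    fun z hz => by have := abs_le.1 (hbd z hz); simp only [Pi.sub_apply]; linarith
  have hu2 := HarmonicOnNhd.le_of_le_diff hKc hOo hOK (hDc.sub huc) (hDh.sub huh) hbc hbh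
    fun z hz => by have := abs_le.1 (hbd z hz); simp only [Pi.sub_apply]; linarith
  intro z hz hz1
  have hzK : z ∈ K := hOK ⟨hz, hz1⟩
  have h1 := hu1 z hzK
  have h2 := hu2 z hzK
  simp only [Pi.sub_apply] at h1 h2
  rw [← hDP hz, abs_le]
  constructor <;> linarith

end IsCosSolution

/-! ### Boundary values of the limit. -/

/-- Boundary values of a limit of solutions with data `cos (k x₁)` along a sequence `k → ∞` for
which the data equal `1` on the flat sides. -/
theorem tendsto_boundary_of_tendsto_isCosSolution {R : ℝ} (hR : 0 < R) {k : ℕ → ℝ}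
    {u : ℕ → ℂ → ℝ} {v : ℂ → ℝ} (hu : ∀ n, IsCosSolution R (k n) (u n))
    (hk : Tendsto k atTop atTop) (hk1 : ∀ n, Real.cos (k n * R) = 1)
    (huv : ∀ z ∈ complexStadium R, Tendsto (fun n => u n z) atTop (𝓝 (v z)))
    {p : ℂ} (hp : p ∈ closedComplexStadium R \ complexStadium R) :
    (|p.re| = R → |p.im| < 1 → Tendsto v (𝓝[complexStadium R] p) (𝓝 1)) ∧
      (|p.re| < R → Tendsto v (𝓝[complexStadium R] p) (𝓝 0)) := by
  constructor
  · intro h1 h2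
    obtain ⟨τ, hτ, hτp⟩ := exists_abs_eq_mul p.re
    have hc : Tendsto (flatBarrier R τ p.im) (𝓝[complexStadium R] p) (𝓝 0) := by
      have := (continuous_flatBarrier R τ p.im).continuousWithinAt (s := complexStadium R) (x := p)
      rw [ContinuousWithinAt, flatBarrier_eq hτ, ← hτp, h1] at this
      simpa using this
    refine tendsto_of_forall_abs_sub_le hc fun ε hε => ⟨2 / (1 - |p.im|) ^ 2, fun z hz => ?_⟩
    have hzC := complexStadium_subset R hz
    have e1 : 1 + -(2 / (1 - |p.im|) ^ 2) * flatBarrier R τ p.im z ≤ v z :=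
      ge_of_tendsto (huv z hz) (Eventually.of_forall fun n =>
        (hu n).one_sub_flatBarrier_le (hk1 n) hτ h2 z hzC)
    have e2 : v z ≤ 1 := le_of_tendsto (huv z hz) (Eventually.of_forall fun n =>
      (abs_le.1 ((hu n).abs_le_one z hzC)).2)
    rw [abs_le]
    constructor <;> linarith
  · intro h1
    rcases closedComplexStadium_diff hp with ⟨h2, -⟩ | ⟨-, h2⟩
    · exact absurd h2 h1.ne
    obtain ⟨σ, hσ, hσp⟩ := exists_abs_eq_mul p.im
    rw [hσp] at h2
    have hσ2 := sq_eq_one_of_abs_eq_one hσ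
    have hc : Tendsto (discBarrier (σ * I) p) (𝓝[complexStadium R] p) (𝓝 0) := by
      have := (continuous_discBarrier (σ * I) p).continuousWithinAt (s := complexStadium R) (x := p)
      rwa [ContinuousWithinAt, discBarrier_self] at this
    have hpi : 1 < σ * p.im := by
      rw [h2]
      linarith [Real.sqrt_pos.2 (sq_lt_of_abs_re_lt h1)]
    -- The comparison holds only in the half disc, which suffices because p lies strictly beyond the
    -- diameter.
    have hloc : 𝓝[complexStadium R ∩ {z | 1 < σ * z.im}] p = 𝓝[complexStadium R] p :=
      nhdsWithin_inter_of_mem' (mem_nhdsWithin_of_mem_nhds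
        ((isOpen_lt (by fun_prop) (by fun_prop)).mem_nhds hpi))
    rw [← hloc] at hc ⊢
    refine tendsto_of_forall_abs_sub_le hc fun ε hε => ⟨2 / (R * (R - |p.re|)), fun z hz => ?_⟩
    obtain ⟨hzS, hz1⟩ := hz
    have hz1' : 1 < σ * z.im := hz1
    have hzb : z ∈ ball (σ * I : ℂ) R := by
      rw [mem_ball_iff_norm]
      refine lt_of_pow_lt_pow_left₀ 2 hR.le ?_
      rw [norm_sq_sub_mul_I]
      have e1 := (mul_le_abs_of_abs_eq_one hσ z.im).trans_lt hzS.2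
      have e2 := Real.sq_sqrt (sq_lt_of_abs_re_lt hzS.1).le
      have e3 : (z.im - σ) ^ 2 = (σ * z.im - 1) ^ 2 := by
        linear_combination (1 - z.im ^ 2) * hσ2
      have e4 : (σ * z.im - 1) ^ 2 < √(R ^ 2 - z.re ^ 2) ^ 2 :=
        pow_lt_pow_left₀ (by linarith) (by linarith) two_ne_zero
      rw [e3]
      linarith
    -- With z fixed, k → ∞ removes the Poisson integral and leaves |v z| bounded by the barrier;
    -- only afterwards does z approach p.
    have hP := (tendsto_poissonIntegral_cos_re (by simp) hzb).comp hk
    have hlim := ((huv z hzS).sub hP).abs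
    rw [sub_zero] at hlim ⊢
    have := le_of_tendsto hlim (Eventually.of_forall fun n =>
      (hu n).abs_sub_poissonIntegral_le hR hσ h1 h2 z hzb hz1')
    linarith

/-! ### Transfer to the Euclidean plane. -/

/-- The Laplacian may be computed in any orthonormal basis, and an isometry carries one such basis
to another. -/
theorem laplacian_comp_linearIsometryEquiv {E F : Type*} [NormedAddCommGroup E]
    [InnerProductSpace ℝ E] [FiniteDimensional ℝ E] [NormedAddCommGroup F]
    [InnerProductSpace ℝ F] [FiniteDimensional ℝ F] (e : E ≃ₗᵢ[ℝ] F) (u : F → ℝ) (x : E) :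
    Laplacian.laplacian (u ∘ e) x = Laplacian.laplacian u (e x) := by
  rw [laplacian_eq_iteratedFDeriv_orthonormalBasis _ (stdOrthonormalBasis ℝ E),
    laplacian_eq_iteratedFDeriv_orthonormalBasis _ ((stdOrthonormalBasis ℝ E).map e)]
  refine Finset.sum_congr rfl fun i _ => ?_
  have := e.toContinuousLinearEquiv.iteratedFDerivWithin_comp_right u uniqueDiffOn_univ
    (x := x) (mem_univ _) 2
  rw [preimage_univ, iteratedFDerivWithin_univ, iteratedFDerivWithin_univ] at this
  erw [this]
  rw [ContinuousMultilinearMap.compContinuousLinearMap_apply]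
  congr 1
  ext j
  fin_cases j <;> simp

theorem InnerProductSpace.HarmonicAt.comp_linearIsometryEquiv {E F : Type*}
    [NormedAddCommGroup E] [InnerProductSpace ℝ E] [FiniteDimensional ℝ E] [NormedAddCommGroup F]
    [InnerProductSpace ℝ F] [FiniteDimensional ℝ F] (e : E ≃ₗᵢ[ℝ] F) {u : F → ℝ} {x : E}
    (h : HarmonicAt u (e x)) : HarmonicAt (u ∘ e) x := by
  refine ⟨h.1.comp x e.contDiff.contDiffAt, ?_⟩
  filter_upwards [e.continuous.continuousAt.eventually h.2] with y hy
  rw [laplacian_comp_linearIsometryEquiv, hy]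
  rfl

/-- The stadium is star-shaped about 0: for 0 < t < 1 the point tz lies in the open stadium. -/
theorem closedComplexStadium_subset_closure {R : ℝ} (hR : 0 < R) :
    closedComplexStadium R ⊆ closure (complexStadium R) := by
  intro z hz
  have hc : Tendsto (fun t : ℝ => (t : ℂ) * z) (𝓝[<] 1) (𝓝 z) := by
    have : Continuous fun t : ℝ => (t : ℂ) * z := by fun_prop
    simpa using (this.tendsto 1).mono_left nhdsWithin_le_nhds
  refine mem_closure_of_tendsto hc ?_
  filter_upwards [Ioo_mem_nhdsLT zero_lt_one] with t ht
  have hz2 : z.re ^ 2 ≤ R ^ 2 := sq_le_sq' (abs_le.1 hz.1).1 (abs_le.1 hz.1).2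
  refine ⟨?_, ?_⟩
  · rw [re_ofReal_mul, abs_mul, abs_of_pos ht.1]
    nlinarith [ht.1, ht.2, hz.1]
  · rw [im_ofReal_mul, abs_mul, abs_of_pos ht.1, re_ofReal_mul]
    have h1 : t * √(R ^ 2 - z.re ^ 2) ≤ √(R ^ 2 - (t * z.re) ^ 2) := by
      refine Real.le_sqrt_of_sq_le ?_
      rw [mul_pow, Real.sq_sqrt (by linarith)]
      nlinarith [mul_nonneg (sub_nonneg.2 (pow_le_one₀ (n := 2) ht.1.le ht.2.le)) (sq_nonneg R)]
    have h2 := mul_le_mul_of_nonneg_left hz.2 ht.1.le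
    nlinarith [ht.2]

/-- The identification of the Euclidean plane with `ℂ`. -/
noncomputable def planeEquiv : EuclideanSpace ℝ (Fin 2) ≃ₗᵢ[ℝ] ℂ :=
  Complex.orthonormalBasisOneI.repr.symm

theorem planeEquiv_re (x : EuclideanSpace ℝ (Fin 2)) : (planeEquiv x).re = x 0 := by
  simp [planeEquiv]

theorem planeEquiv_im (x : EuclideanSpace ℝ (Fin 2)) : (planeEquiv x).im = x 1 := by
  simp [planeEquiv]

theorem stadium_eq_preimage (R : ℝ) : stadium R = planeEquiv ⁻¹' complexStadium R := by
  ext x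
  simp [stadium, complexStadium, planeEquiv_re, planeEquiv_im]

theorem closure_stadium {R : ℝ} (hR : 0 < R) :
    closure (stadium R) = planeEquiv ⁻¹' closedComplexStadium R := by
  have h : closure (complexStadium R) = closedComplexStadium R :=
    (closure_minimal (complexStadium_subset R) (isClosed_closedComplexStadium R)).antisymm
      (closedComplexStadium_subset_closure hR)
  rw [← h, stadium_eq_preimage]
  exact (planeEquiv.toHomeomorph.preimage_closure _).symm

theorem isOpen_stadium (R : ℝ) : IsOpen (stadium R) := by
  rw [stadium_eq_preimage]
  exact (isOpen_complexStadium R).preimage planeEquiv.continuous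

theorem frontier_stadium {R : ℝ} (hR : 0 < R) :
    frontier (stadium R) = planeEquiv ⁻¹' (closedComplexStadium R \ complexStadium R) := by
  rw [(isOpen_stadium R).frontier_eq, closure_stadium hR, stadium_eq_preimage]
  rfl

theorem mem_frontier_stadium {R : ℝ} (hR : 0 < R) {x : EuclideanSpace ℝ (Fin 2)} :
    x ∈ frontier (stadium R) ↔
      (|x 0| = R ∧ |x 1| ≤ 1) ∨ (|x 0| < R ∧ |x 1| = 1 + √(R ^ 2 - x 0 ^ 2)) := by
  rw [frontier_stadium hR, ← planeEquiv_re, ← planeEquiv_im]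
  refine ⟨closedComplexStadium_diff, ?_⟩
  rintro (⟨h1, h2⟩ | ⟨h1, h2⟩)
  · refine ⟨⟨h1.le, h2.trans ?_⟩, fun h => h.1.ne h1⟩
    linarith [Real.sqrt_nonneg (R ^ 2 - (planeEquiv x).re ^ 2)]
  · exact ⟨⟨h1.le, h2.le⟩, fun h => h.2.ne h2⟩

theorem IsCosSolution.isDirichletSolution {R k : ℝ} (hR : 0 < R) {u : ℂ → ℝ}
    (hu : IsCosSolution R k u) :
    IsDirichletSolution (stadium R) (fun x => Real.cos (k * x 0)) (u ∘ planeEquiv) where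
  continuousOn := by
    rw [closure_stadium hR]
    exact hu.continuousOn.comp planeEquiv.continuous.continuousOn (mapsTo_preimage _ _)
  harmonic := by
    rw [stadium_eq_preimage]
    exact fun x hx => (hu.harmonic _ hx).comp_linearIsometryEquiv planeEquiv
  boundary x hx := by
    rw [frontier_stadium hR] at hx
    rw [← planeEquiv_re]
    exact hu.boundary _ hx

theorem tendsto_planeEquiv_nhdsWithin (R : ℝ) (x : EuclideanSpace ℝ (Fin 2)) :
    Tendsto planeEquiv (𝓝[stadium R] x) (𝓝[complexStadium R] (planeEquiv x)) := by
  rw [stadium_eq_preimage]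
  exact planeEquiv.continuous.continuousWithinAt.tendsto_nhdsWithin (mapsTo_preimage _ _)

/-! ### Discontinuity at the junction and conclusion. -/

/-- A boundary value of `u` at `q` is the limit at `q` of the boundary values of `u`. -/
theorem HasBoundaryValue.tendsto {Ω B : Set (EuclideanSpace ℝ (Fin 2))}
    {u φ : EuclideanSpace ℝ (Fin 2) → ℝ} {q : EuclideanSpace ℝ (Fin 2)} {a : ℝ}
    (h : HasBoundaryValue Ω u q a) (hB : B ⊆ closure Ω)
    (hφ : ∀ x ∈ B, HasBoundaryValue Ω u x (φ x)) : Tendsto φ (𝓝[B] q) (𝓝 a) := by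
  rw [Metric.tendsto_nhds]
  intro η hη
  have h1 := Metric.tendsto_nhds.1 h (η / 2) (half_pos hη)
  obtain ⟨V, hVu, hV, hqV⟩ := _root_.eventually_nhds_iff.1 (eventually_nhdsWithin_iff.1 h1)
  filter_upwards [self_mem_nhdsWithin, mem_nhdsWithin_of_mem_nhds (hV.mem_nhds hqV)] with x hxB hxV
  have : (𝓝[Ω] x).NeBot := mem_closure_iff_nhdsWithin_neBot.1 (hB hxB)
  refine lt_of_le_of_lt (le_of_tendsto ((hφ x hxB).dist tendsto_const_nhds) ?_) (half_lt_self hη)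
  filter_upwards [self_mem_nhdsWithin, mem_nhdsWithin_of_mem_nhds (hV.mem_nhds hxV)] with y hy hyV
  exact (hVu y hyV hy).le

/-- The boundary points other than the junctions, on a flat side or on an arc, accumulate at
`(R, 1)`. -/
theorem not_tendsto_junction {R : ℝ} (hR : 0 < R) {φ : EuclideanSpace ℝ (Fin 2) → ℝ}
    (h1 : ∀ x ∈ frontier (stadium R), |x 0| = R → φ x = 1)
    (h0 : ∀ x ∈ frontier (stadium R), |x 0| < R → φ x = 0) (a : ℝ) :
    ¬ Tendsto φ (𝓝[frontier (stadium R) \ stadiumJunctions R] !₂[R, 1]) (𝓝 a) := by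
  intro h
  have hpos : ∀ᶠ t : ℝ in 𝓝[>] 0, 0 < t ∧ t < min 1 R :=
    Ioo_mem_nhdsGT (lt_min one_pos hR)
  have hγ₁ : Continuous fun t : ℝ => (!₂[R, 1 - t] : EuclideanSpace ℝ (Fin 2)) := by fun_prop
  have hγ₂ : Continuous fun t : ℝ =>
      (!₂[R - t, 1 + √(R ^ 2 - (R - t) ^ 2)] : EuclideanSpace ℝ (Fin 2)) := by fun_prop
  have hm₁ : ∀ t : ℝ, 0 < t → t < min 1 R → (!₂[R, 1 - t] : EuclideanSpace ℝ (Fin 2)) ∈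
      frontier (stadium R) \ stadiumJunctions R := by
    intro t ht ht1
    have ht1 := (lt_min_iff.1 ht1).1
    have e : |1 - t| = 1 - t := abs_of_pos (by linarith)
    refine ⟨(mem_frontier_stadium hR).2 (Or.inl ?_), ?_⟩
    · simp [abs_of_pos hR, e, ht.le]
    · simp [stadiumJunctions, e, ht.ne']
  have hm₂ : ∀ t : ℝ, 0 < t → t < min 1 R →
      (!₂[R - t, 1 + √(R ^ 2 - (R - t) ^ 2)] : EuclideanSpace ℝ (Fin 2)) ∈
        frontier (stadium R) \ stadiumJunctions R := by
    intro t ht ht1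
    have ht1 := (lt_min_iff.1 ht1).2
    have e : |R - t| = R - t := abs_of_pos (by linarith)
    refine ⟨(mem_frontier_stadium hR).2 (Or.inr ?_), ?_⟩
    · have : 0 ≤ 1 + √(R ^ 2 - (R - t) ^ 2) := by positivity
      simp [e, ht, abs_of_nonneg this]
    · simp [stadiumJunctions, e, ht.ne']
  have l₁ : Tendsto (fun t : ℝ => φ !₂[R, 1 - t]) (𝓝[>] 0) (𝓝 a) := by
    refine h.comp (tendsto_nhdsWithin_iff.2 ⟨?_, hpos.mono fun t ht => hm₁ t ht.1 ht.2⟩)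
    simpa using (hγ₁.tendsto 0).mono_left nhdsWithin_le_nhds
  have l₂ : Tendsto (fun t : ℝ => φ !₂[R - t, 1 + √(R ^ 2 - (R - t) ^ 2)]) (𝓝[>] 0) (𝓝 a) := by
    refine h.comp (tendsto_nhdsWithin_iff.2 ⟨?_, hpos.mono fun t ht => hm₂ t ht.1 ht.2⟩)
    simpa using (hγ₂.tendsto 0).mono_left nhdsWithin_le_nhds
  have a1 : a = 1 := tendsto_nhds_unique l₁ (tendsto_const_nhds.congr' (hpos.mono fun t ht =>
    (h1 _ (hm₁ t ht.1 ht.2).1 (by simp [abs_of_pos hR])).symm))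
  have a0 : a = 0 := tendsto_nhds_unique l₂ (tendsto_const_nhds.congr' (hpos.mono fun t ht => by
    refine (h0 _ (hm₂ t ht.1 ht.2).1 ?_).symm
    have := (lt_min_iff.1 ht.2).2
    have e : |R - t| = R - t := abs_of_pos (by linarith)
    simp [e, ht.1]))
  linarith

theorem integral_cos_two_pi_mul : ∫ t in (0 : ℝ)..1, Real.cos (2 * π * t) = 0 := by
  rw [intervalIntegral.integral_comp_mul_left (fun t => Real.cos t) (by positivity)]
  simp

theorem mainTheorem6 (R : ℝ) (hR : 0 < R) :
    ∃ g : ℝ → ℝ, ContDiff ℝ ∞ g ∧ Function.Periodic g 1 ∧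
    -- the family of solutions with oscillating boundary data
    ∃ U : ℝ → EuclideanSpace ℝ (Fin 2) → ℝ,
      (∀ ε : ℝ, 0 < ε → IsDirichletSolution (stadium R) (fun x => g (x 0 / ε)) (U ε)) ∧
    -- a subsequence and its limit
    ∃ (ε : ℕ → ℝ) (u : EuclideanSpace ℝ (Fin 2) → ℝ),
      (∀ i, 0 < ε i) ∧ Tendsto ε atTop (𝓝 0) ∧
      TendstoLocallyUniformlyOn (fun i => U (ε i)) u atTop (stadium R) ∧
      InnerProductSpace.HarmonicOnNhd u (stadium R) ∧
    -- the homogenized boundary data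
    ∃ φ : EuclideanSpace ℝ (Fin 2) → ℝ,
      (∀ x ∈ frontier (stadium R) \ stadiumJunctions R,
        HasBoundaryValue (stadium R) u x (φ x)) ∧
      (∀ x ∈ frontier (stadium R), |x 0| < R → φ x = ∫ t in (0 : ℝ)..1, g t) ∧
      (∀ x ∈ frontier (stadium R), x 0 = R → |x 1| < 1 → IsGreatest (range g) (φ x)) ∧
      -- discontinuity at `(R, 1)`, whatever value is prescribed at that point
      (¬ ∃ a : ℝ, Tendsto φ (𝓝[frontier (stadium R) \ {!₂[R, 1]}] !₂[R, 1]) (𝓝 a)) ∧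
      (¬ ∃ a : ℝ, HasBoundaryValue (stadium R) u !₂[R, 1] a) := by
  classical
  choose V hV using fun ε : ℝ => exists_isCosSolution hR (2 * π / ε)
  -- Chosen so that R/ε is an integer, which puts the flat sides at maxima of the data.
  let ε₀ : ℕ → ℝ := fun n => R / (n + 1)
  have hε₀ : ∀ n, 0 < ε₀ n := fun n => by positivity
  have hk : ∀ n, 2 * π / ε₀ n = 2 * π / R * (n + 1) := fun n => by
    simp only [ε₀]
    field_simp
  obtain ⟨ψ, v, hψ, hv, hlim⟩ := (isOpen_complexStadium R).exists_subseq_harmonic_tendsto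
    (u := fun n => V (ε₀ n)) one_pos (fun n => (hV _).harmonic)
    fun n z hz => (hV _).abs_le_one z (complexStadium_subset R hz)
  have hε₀lim : Tendsto ε₀ atTop (𝓝 0) := by
    simpa [ε₀, div_eq_mul_one_div R] using tendsto_one_div_add_atTop_nhds_zero_nat.const_mul R
  have hklim : Tendsto (fun n => 2 * π / ε₀ (ψ n)) atTop atTop := by
    simp_rw [hk]
    exact (tendsto_atTop_add_const_right _ _ (tendsto_natCast_atTop_atTop.comp
      hψ.tendsto_atTop)).const_mul_atTop (by positivity)
  have hk1 : ∀ n, Real.cos (2 * π / ε₀ (ψ n) * R) = 1 := fun n => by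
    have : 2 * π / ε₀ (ψ n) * R = ((ψ n + 1 : ℕ) : ℝ) * (2 * π) := by
      rw [hk]
      push_cast
      field_simp
    rw [this, Real.cos_nat_mul_two_pi]
  have hbv : ∀ p ∈ closedComplexStadium R \ complexStadium R,
      (|p.re| = R → |p.im| < 1 → Tendsto v (𝓝[complexStadium R] p) (𝓝 1)) ∧
        (|p.re| < R → Tendsto v (𝓝[complexStadium R] p) (𝓝 0)) := fun p hp =>
    tendsto_boundary_of_tendsto_isCosSolution hR (fun n => hV (ε₀ (ψ n))) hklim hk1
      (fun z hz => hlim.tendsto_at hz) hp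
  -- The value 1 at the junctions is a mere default; no boundary value is claimed there.
  set φ : EuclideanSpace ℝ (Fin 2) → ℝ := fun x => if |x 0| < R then 0 else 1 with hφ
  have hφ0 : ∀ x ∈ frontier (stadium R), |x 0| < R → φ x = 0 := fun x _ h => if_pos h
  have hφ1 : ∀ x ∈ frontier (stadium R), |x 0| = R → φ x = 1 := fun x _ h => if_neg h.not_lt
  have hφv : ∀ x ∈ frontier (stadium R) \ stadiumJunctions R,
      HasBoundaryValue (stadium R) (v ∘ planeEquiv) x (φ x) := by
    intro x hx
    have hxC : planeEquiv x ∈ closedComplexStadium R \ complexStadium R := by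
      have := hx.1
      rwa [frontier_stadium hR] at this
    have hb := hbv _ hxC
    rw [planeEquiv_re, planeEquiv_im] at hb
    rcases (mem_frontier_stadium hR).1 hx.1 with ⟨h1, h2⟩ | ⟨h1, -⟩
    · rw [hφ1 x hx.1 h1]
      exact (hb.1 h1 (lt_of_le_of_ne h2 fun h => hx.2 ⟨h1, h⟩)).comp
        (tendsto_planeEquiv_nhdsWithin R x)
    · rw [hφ0 x hx.1 h1]
      exact (hb.2 h1).comp (tendsto_planeEquiv_nhdsWithin R x)
  have hjun := not_tendsto_junction hR hφ1 hφ0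
  refine ⟨fun t => Real.cos (2 * π * t), by fun_prop, fun t => ?_, fun ε => V ε ∘ planeEquiv,
    fun ε _ => ?_, fun i => ε₀ (ψ i), v ∘ planeEquiv, fun i => hε₀ _,
    hε₀lim.comp hψ.tendsto_atTop, ?_, ?_, φ, hφv, fun x hx h => ?_, fun x hx h _ => ?_, ?_, ?_⟩
  · simp only [mul_add, mul_one, Real.cos_add_two_pi]
  · have := (hV ε).isDirichletSolution hR
    simpa only [div_mul_eq_mul_div, ← mul_div_assoc] using this
  · refine hlim.comp planeEquiv ?_ planeEquiv.continuous.continuousOn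
    rw [stadium_eq_preimage]
    exact mapsTo_preimage _ _
  · rw [stadium_eq_preimage]
    exact fun x hx => (hv _ hx).comp_linearIsometryEquiv planeEquiv
  · rw [hφ0 x hx h, integral_cos_two_pi_mul]
  · rw [hφ1 x hx (by rw [h, abs_of_pos hR])]
    exact ⟨⟨0, by simp⟩, by rintro _ ⟨t, rfl⟩; exact Real.cos_le_one _⟩
  · rintro ⟨a, ha⟩
    -- A limit with only (R, 1) removed restricts to the smaller set with all four junctions
    -- removed.
    refine hjun a (ha.mono_left (nhdsWithin_mono _ (sdiff_subset_sdiff_right ?_)))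
    rintro _ rfl
    simp [stadiumJunctions, abs_of_pos hR]
  · rintro ⟨a, ha⟩
    -- An interior limit at (R, 1) would force φ to converge there along the boundary.
    exact hjun a (ha.tendsto (sdiff_subset.trans frontier_subset_closure) hφv)
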